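/- **Theorem (generalization error for soft label propagation of one-dimensional distributions).** For $\mu,\nu\in\mathcal P(\mathbb R)$ let $W_2^2(\mu,\nu)=\inf_\pi\iint|x-y|^2\,d\pi(x,y)\in[0,\infty]$, the infimum over all couplings $\pi$ of $\mu$ and $\nu$, and let $F_\mu^{-1}(s)=\inf\{x: F_\mu(x)>s\}$ be the generalized inverse of the distribution function of $\mu$. Let $\phi\in L^2[0,1]$, $\phi\ge 0$, and let $\mathcal M_\phi^2$ be the set of $\mu\in\mathcal P(\mathbb R)$ with $|F_\mu^{-1}(s)|\le\phi(s)$ for a.e. $s\in[0,1]$. Let $V$ be a finite set, let $D$ be a probability measure on $V\times\mathcal P(\mathbb R)$ with $D(V\times\mathcal M_\phi^2)=1$, and let $\gamma>0$ and $m\ge 4$. A training set is $S=((v_1,\mu_1),\dots,(v_m,\mu_m))\sim D^m$; its maximal multiplicity is $T(S)=\max_{v\in V}\#\{i: v_i=v\}$. For $f:V\to\mathcal P(\mathbb R)$ put $$R_m(f)=\frac1m\sum_{i=1}^m W_2^2(f(v_i),\mu_i),\qquad R_D(f)=\mathbb E_{(j,\theta)\sim D}\,W_2^2(f(j),\theta).$$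 Consider either of the following two situations. 1. (Graph.) $G$ is a connected simple graph on $V$ with edge weights $\omega_{ij}=\omega_{ji}>0$, $\lambda_1$ is the smallest non-zero eigenvalue of its weighted Laplacian, and for $D^m$-almost every $S$ the map $f_S:V\to\mathcal P(\mathbb R)$ minimizes $$f\mapsto \frac1m\sum_{i=1}^m W_2^2(\mu_i,f(v_i))+\gamma\sum_{\{i,j\}\in E(G)}\omega_{ij}W_2^2(f(i),f(j))$$ over all maps $f:V\to\mathcal P(\mathbb R)$. 2. (Hypergraph.) $\mathcal E$ is a set of subsets of $V$ (hyperedges), $G$ is the clique graph, in which $i\ne j$ are adjacent iff some $E\in\mathcal E$ contains both, with weights $\omega_{ij}=\sum_{E\in\mathcal E,\ \{i,j\}\subset E}|E|^{-2}$; $G$ is connected, $\lambda_1$ is the smallest non-zero eigenvalue of its weighted Laplacian, and for $D^m$-almost every $S$ the map $f_S$ minimizes $$f\mapsto \frac1m\sum_{i=1}^m W_2^2(\mu_i,f(v_i))+\gamma\sum_{E\in\mathcal E}\ \inf_{\nu\in\mathcal P(\mathbb R)}\frac1{|E|}\sum_{i\in E}W_2^2(f(i),\nu)$$ over all maps $f:V\to\mathcal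 P(\mathbb R)$. Let $T\ge 1$ be an integer with $m\gamma\lambda_1>T$, and set $$M=4\|\phi\|_2^2,\qquad \beta=4\|\phi\|_2^2\left[\frac{3\sqrt{Tm}}{(m\gamma\lambda_1-T)^2}+\frac{4}{m\gamma\lambda_1-T}+\frac2m\right].$$ Then for every $\epsilon>0$: if $m\ge 8M^2/\epsilon^2$, then $$\mathbb P_{S\sim D^m}\{T(S)\le T,\ |R_m(f_S)-R_D(f_S)|>\epsilon\}\le\frac{64Mm\beta+8M^2}{m\epsilon^2},$$ and without this restriction on $m$ $$\mathbb P_{S\sim D^m}\{T(S)\le T,\ |R_m(f_S)-R_D(f_S)|>\epsilon+\beta\}\le 2\exp\left(-\frac{m\epsilon^2}{2(m\beta+M)^2}\right),$$ where for $M=0$ the right-hand side of the second bound is read as $2$. If $T\ge m$, the condition $T(S)\le T$ always holds and may be omitted. -/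

import Mathlib

open MeasureTheory
open scoped ENNReal

noncomputable section

namespace SoftLabel

/-- The squared `2`-Wasserstein distance of two probability measures on `ℝ`: the infimum over all
couplings `π` of the transport cost `∬ |x - y|² dπ(x, y)`, with value in `[0, ∞]`. -/
def W2sq (μ ν : ProbabilityMeasure ℝ) : ℝ≥0∞ :=
  ⨅ (π : Measure (ℝ × ℝ))
    (_ : π.map Prod.fst = (μ : Measure ℝ) ∧ π.map Prod.snd = (ν : Measure ℝ)),
    ∫⁻ p, edist p.1 p.2 ^ 2 ∂π

/-- The generalized inverse `s ↦ inf {x | F_μ(x) > s}` of the distribution function of `μ`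
(meaningful for `0 < s < 1`). -/
def quantile (μ : ProbabilityMeasure ℝ) (s : ℝ) : ℝ :=
  sInf {x : ℝ | s < ProbabilityTheory.cdf (μ : Measure ℝ) x}

/-- The dominated quantile class: `|F_μ⁻¹(s)| ≤ φ(s)` for almost every `s ∈ [0, 1]`. -/
def dominatedQuantileClass (φ : ℝ → ℝ) : Set (ProbabilityMeasure ℝ) :=
  {μ | ∀ᵐ s ∂(volume.restrict (Set.Icc (0 : ℝ) 1)), |quantile μ s| ≤ φ s}

/-- `‖φ‖₂²` in `L²[0, 1]`. -/
def sqNorm (φ : ℝ → ℝ) : ℝ := ∫ s in Set.Icc (0 : ℝ) 1, φ s ^ 2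

/-- An undirected simple graph with symmetric weights, positive exactly on the edges. -/
structure WeightedGraph (V : Type*) where
  graph : SimpleGraph V
  weight : V → V → ℝ
  weight_symm : ∀ i j, weight i j = weight j i
  weight_pos : ∀ i j, graph.Adj i j → 0 < weight i j
  weight_eq_zero : ∀ i j, ¬ graph.Adj i j → weight i j = 0

section Graph

variable {V : Type*} [Fintype V] [DecidableEq V]

/-- The weighted Laplacian: degree matrix minus weighted adjacency matrix. -/
def WeightedGraph.laplacian (G : WeightedGraph V) : Matrix V V ℝ :=
  Matrix.diagonal (fun i => ∑ j, G.weight i j) - Matrix.of G.weight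

/-- `l` is the smallest non-zero eigenvalue of the Laplacian of `G`. -/
def WeightedGraph.IsSpectralGap (G : WeightedGraph V) (l : ℝ) : Prop :=
  IsLeast {x : ℝ | x ≠ 0 ∧ Module.End.HasEigenvalue (Matrix.toLin' G.laplacian) x} l

/-- The weighted clique graph of the hypergraph on `V` with set of hyperedges `𝓔`: distinct vertices are adjacent if they lie in a
common hyperedge, and the edge `{i, j}` has weight `∑ 1 / |E|²` over the hyperedges `E`
that contain `i` and `j`. -/
def cliqueGraph (𝓔 : Finset (Finset V)) : WeightedGraph V where
  graph :=
    { Adj := fun i j => i ≠ j ∧ ∃ E ∈ 𝓔, i ∈ E ∧ j ∈ E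
      symm := ⟨fun _ _ h => ⟨h.1.symm, h.2.imp fun _ hE => ⟨hE.1, hE.2.2, hE.2.1⟩⟩⟩
      loopless := ⟨fun _ h => h.1 rfl⟩ }
  weight := fun i j =>
    if i = j then 0
    else ∑ E ∈ 𝓔.filter (fun E => i ∈ E ∧ j ∈ E), 1 / (E.card : ℝ) ^ 2
  weight_symm := fun i j => by
    simp only [eq_comm (a := i) (b := j), and_comm (a := i ∈ _)]
  weight_pos := fun i j h => by
    obtain ⟨hij, E, hE, hi, hj⟩ := h
    rw [if_neg hij]
    refine Finset.sum_pos (fun F hF => ?_) ⟨E, Finset.mem_filter.2 ⟨hE, hi, hj⟩⟩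
    have : 0 < F.card := Finset.card_pos.2 ⟨i, (Finset.mem_filter.1 hF).2.1⟩
    positivity
  weight_eq_zero := fun i j h => by
    split_ifs with hij
    · rfl
    · refine Finset.sum_eq_zero fun F hF => ?_
      have hF' := Finset.mem_filter.1 hF
      exact absurd ⟨hij, F, hF'.1, hF'.2⟩ h

/-- The data term `(1/m) ∑ᵢ W₂²(μᵢ, f(vᵢ))` of a training set `S = ((v₁, μ₁), …, (vₘ, μₘ))`;
it is also the empirical risk of `f` for the cost `c(f, (j, θ)) = W₂²(f(j), θ)`. -/
def empiricalRisk {m : ℕ} (S : Fin m → V × ProbabilityMeasure ℝ)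
    (f : V → ProbabilityMeasure ℝ) : ℝ≥0∞ :=
  (m : ℝ≥0∞)⁻¹ * ∑ i, W2sq (f (S i).1) (S i).2

/-- The Tikhonov objective on a weighted graph. Half of the sum over ordered pairs of vertices
counts every edge once. -/
def graphObjective (G : WeightedGraph V) (γ : ℝ) {m : ℕ}
    (S : Fin m → V × ProbabilityMeasure ℝ) (f : V → ProbabilityMeasure ℝ) : ℝ≥0∞ :=
  empiricalRisk S f +
    ENNReal.ofReal γ *
      (2⁻¹ * ∑ i, ∑ j, ENNReal.ofReal (G.weight i j) * W2sq (f i) (f j))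

/-- The barycenter value `inf_ν (1/|E|) ∑_{i ∈ E} W₂²(f(i), ν)` of a hyperedge. -/
def bar (f : V → ProbabilityMeasure ℝ) (E : Finset V) : ℝ≥0∞ :=
  ⨅ ν : ProbabilityMeasure ℝ, (E.card : ℝ≥0∞)⁻¹ * ∑ i ∈ E, W2sq (f i) ν

/-- The Tikhonov objective on the hypergraph on `V` with set of hyperedges `𝓔`. -/
def hypergraphObjective (𝓔 : Finset (Finset V)) (γ : ℝ) {m : ℕ}
    (S : Fin m → V × ProbabilityMeasure ℝ) (f : V → ProbabilityMeasure ℝ) : ℝ≥0∞ :=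
  empiricalRisk S f + ENNReal.ofReal γ * ∑ E ∈ 𝓔, bar f E

/-- The largest number of times that a vertex occurs in the training set. -/
def maxMultiplicity {m : ℕ} (S : Fin m → V × ProbabilityMeasure ℝ) : ℕ :=
  Finset.univ.sup fun v : V => (Finset.univ.filter fun i => (S i).1 = v).card

/-- The generalization error `E_{(j, θ) ∼ D} W₂²(f(j), θ)`. -/
def trueRisk [MeasurableSpace V] (D : Measure (V × ProbabilityMeasure ℝ))
    (f : V → ProbabilityMeasure ℝ) : ℝ≥0∞ :=
  ∫⁻ z, W2sq (f z.1) z.2 ∂D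

/-- `|R_m(f) - R_D(f)|`. -/
def riskGap [MeasurableSpace V] (D : Measure (V × ProbabilityMeasure ℝ)) {m : ℕ}
    (S : Fin m → V × ProbabilityMeasure ℝ) (f : V → ProbabilityMeasure ℝ) : ℝ :=
  |(empiricalRisk S f).toReal - (trueRisk D f).toReal|

/-- The two bounds for the learning algorithm `S ↦ A S`, on the event that no vertex occurs more
than `T` times in the training set (the sure event if `m ≤ T`). -/
def GeneralizationBounds [MeasurableSpace V] (D : Measure (V × ProbabilityMeasure ℝ)) {m : ℕ}
    (A : (Fin m → V × ProbabilityMeasure ℝ) → V → ProbabilityMeasure ℝ)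
    (T : ℕ) (M β : ℝ) : Prop :=
  ∀ ε : ℝ, 0 < ε →
    (8 * M ^ 2 / ε ^ 2 ≤ m →
      Measure.pi (fun _ : Fin m => D) {S | maxMultiplicity S ≤ T ∧ ε < riskGap D S (A S)} ≤
        ENNReal.ofReal ((64 * M * m * β + 8 * M ^ 2) / (m * ε ^ 2))) ∧
    Measure.pi (fun _ : Fin m => D) {S | maxMultiplicity S ≤ T ∧ ε + β < riskGap D S (A S)} ≤
      ENNReal.ofReal (2 * Real.exp (-(m * ε ^ 2 / (2 * (m * β + M) ^ 2))))

end Graph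

/-- The stability constant
`4‖φ‖₂² [3√(Tm) / (mγλ₁ - T)² + 4 / (mγλ₁ - T) + 2 / m]`. -/
def beta (φ : ℝ → ℝ) (m T : ℕ) (γ l : ℝ) : ℝ :=
  4 * sqNorm φ *
    (3 * √((T : ℝ) * m) / (m * γ * l - T) ^ 2 + 4 / (m * γ * l - T) + 2 / m)

end SoftLabel

end

/-!
On the line `W₂` is the `L²(0, 1)` distance of quantile functions. The objective is therefore an
integral over levels `s` of a scalar quadratic problem on the graph, whose solution is a weighted
average of the observed quantiles with weights from the inverse of the screened Laplacian
`c L + N`, where `c = m γ` and `N` is the diagonal matrix of the vertex counts. By the maximum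
principle this solution is bounded by the data and increasing in `s`, so it consists of quantiles,
and every minimizer agrees with it at almost every level. The barycenter cost of a hyperedge is its
normalized sum of squared pairwise distances, which reduces hypergraphs to clique graphs.

Deleting one sample changes the scalar solution by a multiple of a column of the inverse, which the
maximum principle and the spectral gap control. Hence the algorithm is uniformly stable, and the two
bounds follow from a second moment estimate and from McDiarmid's inequality.
-/

namespace SoftLabel

section Quantile

open ProbabilityTheory Set

/-- The uniform distribution on `(0, 1)`, the levels at which `quantile` has no junk value. It is
used in place of Lebesgue measure on `[0, 1]`, with which it agrees. -/
noncomputable def unif : Measure ℝ := volume.restrict (Ioo (0 : ℝ) 1)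

theorem unif_eq_restrict_Icc : unif = volume.restrict (Icc (0 : ℝ) 1) :=
  restrict_Ioo_eq_restrict_Icc

instance : IsProbabilityMeasure unif := ⟨by simp [unif]⟩

theorem ae_unif_mem_Ioo : ∀ᵐ s ∂unif, s ∈ Ioo (0 : ℝ) 1 := ae_restrict_mem measurableSet_Ioo

theorem unif_Iio {t : ℝ} (ht : t ≤ 1) : unif (Iio t) = ENNReal.ofReal t := by
  have hinter : Iio t ∩ Ioo 0 1 = Ioo 0 t := by
    ext s
    exact ⟨fun h => ⟨h.2.1, h.1⟩, fun h => ⟨h.2, h.1, h.2.trans_le ht⟩⟩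
  rw [unif, Measure.restrict_apply measurableSet_Iio, hinter, Real.volume_Ioo, sub_zero]

theorem unif_Iic_le (t : ℝ) : unif (Iic t) ≤ ENNReal.ofReal t := by
  rw [unif, Measure.restrict_apply measurableSet_Iic]
  calc volume (Iic t ∩ Ioo 0 1) ≤ volume (Ioc 0 t) := measure_mono fun s hs => ⟨hs.2.1, hs.1⟩
    _ = ENNReal.ofReal t := by rw [Real.volume_Ioc, sub_zero]

variable (μ : ProbabilityMeasure ℝ) {s x : ℝ}

theorem quantileSet_nonempty (hs : s < 1) : {x : ℝ | s < cdf (μ : Measure ℝ) x}.Nonempty :=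
  ((tendsto_cdf_atTop (μ : Measure ℝ)).eventually (lt_mem_nhds hs)).exists

theorem quantileSet_bddBelow (hs : 0 < s) : BddBelow {x : ℝ | s < cdf (μ : Measure ℝ) x} := by
  obtain ⟨a, ha⟩ := ((tendsto_cdf_atBot (μ : Measure ℝ)).eventually (gt_mem_nhds hs)).exists
  exact ⟨a, fun x hx => ((monotone_cdf _).reflect_lt (ha.trans hx)).le⟩

theorem quantile_le_of_lt_cdf (hs : 0 < s) (h : s < cdf (μ : Measure ℝ) x) : quantile μ s ≤ x :=
  csInf_le (quantileSet_bddBelow μ hs) h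

theorem lt_cdf_of_quantile_lt (hs : s < 1) (h : quantile μ s < x) :
    s < cdf (μ : Measure ℝ) x := by
  obtain ⟨y, hy, hyx⟩ := exists_lt_of_csInf_lt (quantileSet_nonempty μ hs) h
  exact lt_of_lt_of_le hy (monotone_cdf _ hyx.le)

theorem le_cdf_of_quantile_le (hs : s < 1) (h : quantile μ s ≤ x) :
    s ≤ cdf (μ : Measure ℝ) x := by
  have hright : Filter.Tendsto (cdf (μ : Measure ℝ)) (nhdsWithin x (Ioi x))
      (nhds (cdf (μ : Measure ℝ) x)) :=
    ((cdf (μ : Measure ℝ)).right_continuous x).mono_left (nhdsWithin_mono _ Ioi_subset_Ici_self)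
  refine ge_of_tendsto hright ?_
  filter_upwards [self_mem_nhdsWithin] with y hy
  exact (lt_cdf_of_quantile_lt μ hs (h.trans_lt hy)).le

theorem monotoneOn_quantile : MonotoneOn (quantile μ) (Ioo 0 1) := fun _ hs _ ht hst =>
  csInf_le_csInf (quantileSet_bddBelow μ hs.1) (quantileSet_nonempty μ ht.2)
    fun _ hx => hst.trans_lt hx

theorem aemeasurable_quantile : AEMeasurable (quantile μ) unif :=
  aemeasurable_restrict_of_monotoneOn measurableSet_Ioo (monotoneOn_quantile μ)

theorem map_quantile : unif.map (quantile μ) = (μ : Measure ℝ) := by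
  have : IsProbabilityMeasure (unif.map (quantile μ)) :=
    Measure.isProbabilityMeasure_map (aemeasurable_quantile μ)
  refine Measure.ext_of_Iic _ _ fun x => ?_
  rw [Measure.map_apply_of_aemeasurable (aemeasurable_quantile μ) measurableSet_Iic, ← ofReal_cdf]
  apply le_antisymm
  · refine le_trans (measure_mono_ae ?_) (unif_Iic_le _)
    filter_upwards [ae_unif_mem_Ioo] with s hs h
    exact le_cdf_of_quantile_le μ hs.2 h
  · rw [← unif_Iio (cdf_le_one _ x)]
    refine measure_mono_ae ?_
    filter_upwards [ae_unif_mem_Ioo] with s hs h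
    exact quantile_le_of_lt_cdf μ hs.1 h

theorem measurable_cdf_apply (r : ℝ) :
    Measurable fun μ : ProbabilityMeasure ℝ => cdf (μ : Measure ℝ) r := by
  simp only [cdf_eq_real, Measure.real]
  exact ((Measure.measurable_coe measurableSet_Iic).comp measurable_subtype_coe).ennreal_toReal

theorem measurable_indicator_quantile :
    Measurable fun p : ProbabilityMeasure ℝ × ℝ =>
      (Ioo (0 : ℝ) 1).indicator (quantile p.1) p.2 := by
  have hlevel : MeasurableSet (Prod.snd ⁻¹' Ioo (0 : ℝ) 1 : Set (ProbabilityMeasure ℝ × ℝ)) :=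
    measurable_snd measurableSet_Ioo
  refine measurable_of_restrict_of_restrict_compl hlevel (measurable_of_Iio fun x => ?_) ?_
  · have hpreimage : (Prod.snd ⁻¹' Ioo (0 : ℝ) 1).domRestrict (fun p : ProbabilityMeasure ℝ × ℝ =>
        (Ioo (0 : ℝ) 1).indicator (quantile p.1) p.2) ⁻¹' Iio x =
        ⋃ r : ℚ, {p | (r : ℝ) < x ∧ p.1.2 < cdf (p.1.1 : Measure ℝ) r} := by
      ext ⟨⟨μ, s⟩, hs⟩
      simp only [mem_preimage, domRestrict_apply, mem_Iio, mem_iUnion, mem_ofPred_eq]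
      rw [indicator_of_mem (show s ∈ Ioo (0 : ℝ) 1 from hs)]
      constructor
      · intro h
        obtain ⟨r, hr, hrx⟩ := exists_rat_btwn h
        exact ⟨r, hrx, lt_cdf_of_quantile_lt μ hs.2 hr⟩
      · rintro ⟨r, hrx, hr⟩
        exact (quantile_le_of_lt_cdf μ hs.1 hr).trans_lt hrx
    rw [hpreimage]
    exact MeasurableSet.iUnion fun r => (MeasurableSet.const _).inter <|
      measurableSet_lt (by fun_prop) ((measurable_cdf_apply r).comp (by fun_prop))
  · convert measurable_const (a := (0 : ℝ)) with p
    exact indicator_of_notMem (s := Ioo (0 : ℝ) 1) p.2 _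

section MapMonotone

variable {μ} {q : ℝ → ℝ} (hq : MonotoneOn q (Ioo 0 1)) (hμ : (μ : Measure ℝ) = unif.map q)

include hq hμ

theorem ofReal_cdf_of_eq_map (t : ℝ) :
    ENNReal.ofReal (cdf (μ : Measure ℝ) t) = unif (q ⁻¹' Iic t) := by
  have hqm : AEMeasurable q unif := aemeasurable_restrict_of_monotoneOn measurableSet_Ioo hq
  rw [ofReal_cdf, hμ, Measure.map_apply_of_aemeasurable hqm measurableSet_Iic]

theorem le_quantile_of_eq_map (hs : s ∈ Ioo (0 : ℝ) 1) : q s ≤ quantile μ s := by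
  by_contra! h
  obtain ⟨t, hqt, htq⟩ := exists_between h
  have hle : unif (q ⁻¹' Iic t) ≤ unif (Iio s) := by
    refine measure_mono_ae ?_
    filter_upwards [ae_unif_mem_Ioo] with r hr hrt
    exact lt_of_not_ge (α := ℝ) fun hsr => ((hq hs hr hsr).trans hrt).not_gt htq
  rw [← ofReal_cdf_of_eq_map hq hμ, unif_Iio hs.2.le,
    ENNReal.ofReal_le_ofReal_iff hs.1.le] at hle
  exact hle.not_gt (lt_cdf_of_quantile_lt μ hs.2 hqt)

theorem quantile_le_of_eq_map {r : ℝ} (hs : 0 < s) (hr : r < 1) (hsr : s < r) :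
    quantile μ s ≤ q r := by
  refine quantile_le_of_lt_cdf μ hs (hsr.trans_le ?_)
  rw [← ENNReal.ofReal_le_ofReal_iff (cdf_nonneg _ _), ofReal_cdf_of_eq_map hq hμ,
    ← unif_Iio hr.le]
  refine measure_mono_ae ?_
  filter_upwards [ae_unif_mem_Ioo] with t ht htr
  exact hq ht ⟨hs.trans hsr, hr⟩ (le_of_lt htr)

theorem quantile_ae_eq_of_eq_map : quantile μ =ᵐ[unif] q := by
  have hcont : ∀ᵐ s ∂unif, s ∉ {t ∈ Ioo (0 : ℝ) 1 | ¬ContinuousWithinAt q (Ioo 0 1) t} :=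
    ae_restrict_of_ae (hq.countable_not_continuousWithinAt.ae_notMem volume)
  filter_upwards [ae_unif_mem_Ioo, hcont] with s hs hqs
  have hqs : ContinuousAt q s :=
    (not_not.1 fun h => hqs ⟨hs, h⟩ : ContinuousWithinAt q (Ioo 0 1) s).continuousAt
      (Ioo_mem_nhds hs.1 hs.2)
  refine le_antisymm ?_ (le_quantile_of_eq_map hq hμ hs)
  refine ge_of_tendsto (hqs.tendsto.mono_left (nhdsWithin_le_nhds (s := Ioi s))) ?_
  filter_upwards [Ioo_mem_nhdsGT hs.2] with r hr
  exact quantile_le_of_eq_map hq hμ hs.1 hr.2 hr.1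

end MapMonotone

theorem exists_quantile_ae_eq {q : ℝ → ℝ} (hq : MonotoneOn q (Ioo 0 1)) :
    ∃ μ : ProbabilityMeasure ℝ, quantile μ =ᵐ[unif] q :=
  ⟨⟨unif.map q, Measure.isProbabilityMeasure_map
    (aemeasurable_restrict_of_monotoneOn measurableSet_Ioo hq)⟩, quantile_ae_eq_of_eq_map hq rfl⟩

end Quantile

section Wasserstein

open ProbabilityTheory Set

theorem volume_setOf_le_inf_sup_lt (x y : ℝ) :
    (volume : Measure (ℝ × ℝ)) {p | y ≤ p.1 ⊓ p.2 ∧ p.1 ⊔ p.2 < x} =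
      ENNReal.ofReal (x - y) ^ 2 := by
  have hsquare : {p : ℝ × ℝ | y ≤ p.1 ⊓ p.2 ∧ p.1 ⊔ p.2 < x} = Ico y x ×ˢ Ico y x := by
    ext p
    simp only [mem_ofPred_eq, le_inf_iff, sup_lt_iff, mem_prod, mem_Ico]
    tauto
  rw [hsquare, Measure.volume_eq_prod, Measure.prod_prod, Real.volume_Ico, sq]

theorem edist_sq_eq_ofReal (x y : ℝ) : edist x y ^ 2 = ENNReal.ofReal ((x - y) ^ 2) := by
  rw [edist_dist, Real.dist_eq, ← ENNReal.ofReal_pow (abs_nonneg _), sq_abs]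

theorem edist_sq_eq_add (x y : ℝ) :
    edist x y ^ 2 = ENNReal.ofReal (x - y) ^ 2 + ENNReal.ofReal (y - x) ^ 2 := by
  wlog h : x ≤ y generalizing x y
  · rw [edist_comm, add_comm, this y x (le_of_not_ge h)]
  rw [edist_sq_eq_ofReal, ENNReal.ofReal_of_nonpos (sub_nonpos.2 h),
    ← ENNReal.ofReal_pow (sub_nonneg.2 h), ← neg_sub y x, neg_sq]
  simp

theorem lintegral_ofReal_sub_sq (π : Measure (ℝ × ℝ)) [SFinite π] :
    ∫⁻ z, ENNReal.ofReal (z.1 - z.2) ^ 2 ∂π =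
      ∫⁻ p : ℝ × ℝ, π {z | z.2 ≤ p.1 ⊓ p.2 ∧ p.1 ⊔ p.2 < z.1} := by
  have hmeas : MeasurableSet {q : (ℝ × ℝ) × (ℝ × ℝ) |
      q.1.2 ≤ q.2.1 ⊓ q.2.2 ∧ q.2.1 ⊔ q.2.2 < q.1.1} := by
    measurability
  have hfubini := (Measure.prod_apply (μ := π) (ν := (volume : Measure (ℝ × ℝ))) hmeas).symm.trans
    (Measure.prod_apply_symm hmeas)
  simpa only [preimage_ofPred_eq, volume_setOf_le_inf_sup_lt] using hfubini

/-- The monotone coupling of two distributions, which is optimal for the quadratic cost. -/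
noncomputable def quantileCoupling (μ ν : ProbabilityMeasure ℝ) : Measure (ℝ × ℝ) :=
  unif.map fun s => (quantile μ s, quantile ν s)

variable (μ ν : ProbabilityMeasure ℝ)

theorem aemeasurable_quantile_prodMk :
    AEMeasurable (fun s => (quantile μ s, quantile ν s)) unif :=
  (aemeasurable_quantile μ).prodMk (aemeasurable_quantile ν)

theorem map_fst_quantileCoupling : (quantileCoupling μ ν).map Prod.fst = (μ : Measure ℝ) := by
  rw [quantileCoupling, AEMeasurable.map_map_of_aemeasurable measurable_fst.aemeasurable
    (aemeasurable_quantile_prodMk μ ν)]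
  exact map_quantile μ

theorem map_swap_quantileCoupling :
    (quantileCoupling μ ν).map Prod.swap = quantileCoupling ν μ :=
  AEMeasurable.map_map_of_aemeasurable measurable_swap.aemeasurable
    (aemeasurable_quantile_prodMk μ ν)

theorem map_snd_quantileCoupling : (quantileCoupling μ ν).map Prod.snd = (ν : Measure ℝ) := by
  rw [← map_swap_quantileCoupling ν μ, Measure.map_map measurable_snd measurable_swap]
  exact map_fst_quantileCoupling ν μ

theorem lintegral_quantileCoupling {f : ℝ × ℝ → ℝ≥0∞} (hf : Measurable f) :
    ∫⁻ z, f z ∂quantileCoupling μ ν = ∫⁻ s, f (quantile μ s, quantile ν s) ∂unif :=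
  lintegral_map' hf.aemeasurable (aemeasurable_quantile_prodMk μ ν)

variable {μ ν} {π : Measure (ℝ × ℝ)}

theorem quantileCoupling_le_of_coupling (hfst : π.map Prod.fst = (μ : Measure ℝ))
    (hsnd : π.map Prod.snd = (ν : Measure ℝ)) (c d : ℝ) :
    quantileCoupling μ ν {z | z.2 ≤ c ∧ d < z.1} ≤ π {z | z.2 ≤ c ∧ d < z.1} := by
  have hmeas : MeasurableSet {z : ℝ × ℝ | z.2 ≤ c ∧ d < z.1} :=
    (measurableSet_le measurable_snd measurable_const).inter
      (measurableSet_lt measurable_const measurable_fst)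
  rw [quantileCoupling, Measure.map_apply_of_aemeasurable (aemeasurable_quantile_prodMk μ ν) hmeas]
  calc unif {s | quantile ν s ≤ c ∧ d < quantile μ s}
      ≤ unif (Icc (cdf (μ : Measure ℝ) d) (cdf (ν : Measure ℝ) c)) := by
        refine measure_mono_ae ?_
        filter_upwards [ae_unif_mem_Ioo] with s hs h
        exact ⟨not_lt.1 fun hlt => (quantile_le_of_lt_cdf μ hs.1 hlt).not_gt h.2,
          le_cdf_of_quantile_le ν hs.2 h.1⟩
    _ ≤ volume (Icc (cdf (μ : Measure ℝ) d) (cdf (ν : Measure ℝ) c)) :=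
        Measure.restrict_apply_le _ _
    _ = (ν : Measure ℝ) (Iic c) - (μ : Measure ℝ) (Iic d) := by
        rw [Real.volume_Icc, ENNReal.ofReal_sub _ (cdf_nonneg _ _), ofReal_cdf, ofReal_cdf]
    _ = π (Prod.snd ⁻¹' Iic c) - π (Prod.fst ⁻¹' Iic d) := by
        rw [← hfst, ← hsnd, Measure.map_apply measurable_fst measurableSet_Iic,
          Measure.map_apply measurable_snd measurableSet_Iic]
    _ ≤ π (Prod.snd ⁻¹' Iic c \ Prod.fst ⁻¹' Iic d) := le_measure_sdiff
    _ ≤ π {z | z.2 ≤ c ∧ d < z.1} := measure_mono fun z hz => ⟨hz.1, not_le.1 hz.2⟩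

theorem lintegral_ofReal_sub_sq_quantileCoupling_le [SFinite π]
    (hfst : π.map Prod.fst = (μ : Measure ℝ)) (hsnd : π.map Prod.snd = (ν : Measure ℝ)) :
    ∫⁻ s, ENNReal.ofReal (quantile μ s - quantile ν s) ^ 2 ∂unif ≤
      ∫⁻ z, ENNReal.ofReal (z.1 - z.2) ^ 2 ∂π := by
  have hfinite : IsFiniteMeasure (quantileCoupling μ ν) :=
    Measure.isFiniteMeasure_map unif fun s => (quantile μ s, quantile ν s)
  rw [← lintegral_quantileCoupling μ ν (f := fun z => ENNReal.ofReal (z.1 - z.2) ^ 2) (by fun_prop),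
    lintegral_ofReal_sub_sq, lintegral_ofReal_sub_sq]
  exact lintegral_mono fun p => quantileCoupling_le_of_coupling hfst hsnd _ _

theorem lintegral_edist_quantile_sq_le (hfst : π.map Prod.fst = (μ : Measure ℝ))
    (hsnd : π.map Prod.snd = (ν : Measure ℝ)) :
    ∫⁻ s, edist (quantile μ s) (quantile ν s) ^ 2 ∂unif ≤ ∫⁻ z, edist z.1 z.2 ^ 2 ∂π := by
  have hfinite : IsFiniteMeasure π := by
    have : IsFiniteMeasure (π.map Prod.fst) := hfst ▸ inferInstance
    exact Measure.isFiniteMeasure_of_map measurable_fst.aemeasurable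
  have hswap := lintegral_ofReal_sub_sq_quantileCoupling_le (π := π.map Prod.swap)
    (by rwa [Measure.map_map measurable_fst measurable_swap])
    (by rwa [Measure.map_map measurable_snd measurable_swap])
  rw [lintegral_map (by fun_prop) measurable_swap] at hswap
  simp only [edist_sq_eq_add]
  have hmeas : AEMeasurable (fun s => ENNReal.ofReal (quantile μ s - quantile ν s) ^ 2) unif :=
    ((aemeasurable_quantile μ).sub (aemeasurable_quantile ν)).ennreal_ofReal.pow_const 2
  rw [lintegral_add_left' hmeas, lintegral_add_left (by fun_prop)]
  exact add_le_add (lintegral_ofReal_sub_sq_quantileCoupling_le hfst hsnd) hswap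

theorem W2sq_eq_lintegral_quantile (μ ν : ProbabilityMeasure ℝ) :
    W2sq μ ν = ∫⁻ s, ENNReal.ofReal ((quantile μ s - quantile ν s) ^ 2) ∂unif := by
  simp only [← edist_sq_eq_ofReal]
  refine le_antisymm ?_ (le_iInf₂ fun π hπ => lintegral_edist_quantile_sq_le hπ.1 hπ.2)
  rw [← lintegral_quantileCoupling μ ν (f := fun z => edist z.1 z.2 ^ 2) (by fun_prop)]
  exact iInf₂_le _ ⟨map_fst_quantileCoupling μ ν, map_snd_quantileCoupling μ ν⟩

theorem W2sq_self (μ : ProbabilityMeasure ℝ) : W2sq μ μ = 0 := by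
  simp [W2sq_eq_lintegral_quantile]

end Wasserstein

section Spectrum

open Matrix

variable {ι : Type*} [Fintype ι] [DecidableEq ι] {A : Matrix ι ι ℝ}

theorem inner_eigenvectorBasis_mulVec (hA : A.IsHermitian) (x : ι → ℝ) (k : ι) :
    inner ℝ (hA.eigenvectorBasis k) (WithLp.toLp 2 (A *ᵥ x)) =
      hA.eigenvalues k * inner ℝ (hA.eigenvectorBasis k) (WithLp.toLp 2 x) := by
  have hsymm : Aᵀ = A := IsSymm.eq (by simpa using hA)
  simp only [EuclideanSpace.inner_eq_star_dotProduct, star_trivial]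
  calc (A *ᵥ x) ⬝ᵥ (hA.eigenvectorBasis k).ofLp
      = (A *ᵥ (hA.eigenvectorBasis k).ofLp) ⬝ᵥ x := by
        rw [dotProduct_comm, dotProduct_mulVec, ← mulVec_transpose, hsymm]
    _ = hA.eigenvalues k * (x ⬝ᵥ (hA.eigenvectorBasis k).ofLp) := by
        rw [hA.mulVec_eigenvectorBasis, smul_dotProduct, smul_eq_mul, dotProduct_comm]

theorem dotProduct_mulVec_eq_sum_eigenvalues (hA : A.IsHermitian) (x : ι → ℝ) :
    x ⬝ᵥ (A *ᵥ x) = ∑ k,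
      hA.eigenvalues k * inner ℝ (hA.eigenvectorBasis k) (WithLp.toLp 2 x) ^ 2 := by
  have hparseval := hA.eigenvectorBasis.sum_inner_mul_inner (WithLp.toLp 2 x)
    (WithLp.toLp 2 (A *ᵥ x))
  rw [EuclideanSpace.inner_eq_star_dotProduct, star_trivial, dotProduct_comm] at hparseval
  rw [← hparseval]
  refine Finset.sum_congr rfl fun k _ => ?_
  rw [inner_eigenvectorBasis_mulVec, real_inner_comm]
  ring

theorem mul_dotProduct_self_le_of_le_eigenvalues (hA : A.IsHermitian) {l : ℝ}
    (hl : ∀ t, t ≠ 0 → Module.End.HasEigenvalue (Matrix.toLin' A) t → l ≤ t) {x : ι → ℝ}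
    (hx : ∀ y, A *ᵥ y = 0 → y ⬝ᵥ x = 0) : l * (x ⬝ᵥ x) ≤ x ⬝ᵥ (A *ᵥ x) := by
  have hnorm : x ⬝ᵥ x = ∑ k, inner ℝ (hA.eigenvectorBasis k) (WithLp.toLp 2 x) ^ 2 := by
    simpa [EuclideanSpace.norm_sq_eq, dotProduct, ← sq] using
      (hA.eigenvectorBasis.sum_sq_norm_inner_right (WithLp.toLp 2 x)).symm
  rw [dotProduct_mulVec_eq_sum_eigenvalues hA, hnorm, Finset.mul_sum]
  refine Finset.sum_le_sum fun k _ => ?_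
  by_cases hk : hA.eigenvalues k = 0
  · have hker : (hA.eigenvectorBasis k).ofLp ⬝ᵥ x = 0 := by
      refine hx _ ?_
      rw [hA.mulVec_eigenvectorBasis, hk, zero_smul]
    rw [EuclideanSpace.inner_eq_star_dotProduct, star_trivial, dotProduct_comm, hker]
    simp
  · refine mul_le_mul_of_nonneg_right (hl _ hk ?_) (sq_nonneg _)
    refine Module.End.hasEigenvalue_of_hasEigenvector (x := (hA.eigenvectorBasis k).ofLp) ?_
    rw [Module.End.hasEigenvector_iff, Module.End.mem_eigenspace_iff]
    exact ⟨hA.mulVec_eigenvectorBasis k, fun h =>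
      hA.eigenvectorBasis.orthonormal.ne_zero k (WithLp.ofLp_injective 2 h)⟩

end Spectrum

namespace WeightedGraph

open Matrix Finset

theorem weight_nonneg {V : Type*} (G : WeightedGraph V) (i j : V) : 0 ≤ G.weight i j := by
  by_cases h : G.graph.Adj i j
  · exact (G.weight_pos i j h).le
  · exact (G.weight_eq_zero i j h).ge

section Laplacian

variable {V : Type*} [Fintype V] [DecidableEq V] (G : WeightedGraph V)

theorem laplacian_mulVec (x : V → ℝ) (i : V) :
    (G.laplacian *ᵥ x) i = ∑ j, G.weight i j * (x i - x j) := by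
  simp only [laplacian, sub_mulVec, Pi.sub_apply, mulVec_diagonal, mul_sub, sum_sub_distrib,
    sum_mul]
  rfl

theorem dotProduct_laplacian (y x : V → ℝ) :
    y ⬝ᵥ (G.laplacian *ᵥ x) = 2⁻¹ * ∑ i, ∑ j, G.weight i j * ((y i - y j) * (x i - x j)) := by
  have hrow : y ⬝ᵥ (G.laplacian *ᵥ x) = ∑ i, ∑ j, G.weight i j * (y i * (x i - x j)) := by
    simp only [dotProduct, G.laplacian_mulVec, mul_sum, mul_left_comm]
  have hswap : ∑ i, ∑ j, G.weight i j * (y i * (x i - x j)) =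
      ∑ i, ∑ j, G.weight i j * (y j * (x j - x i)) := by
    rw [sum_comm]
    simp only [G.weight_symm]
  have hsplit : ∑ i, ∑ j, G.weight i j * ((y i - y j) * (x i - x j)) =
      ∑ i, ∑ j, G.weight i j * (y i * (x i - x j)) +
        ∑ i, ∑ j, G.weight i j * (y j * (x j - x i)) := by
    simp only [← sum_add_distrib]
    exact sum_congr rfl fun i _ => sum_congr rfl fun j _ => by ring
  rw [hrow, hsplit, ← hswap]
  ring

theorem isHermitian_laplacian : G.laplacian.IsHermitian :=
  (isHermitian_diagonal _).sub (Matrix.IsHermitian.ext fun i j => G.weight_symm j i)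

theorem posSemidef_laplacian : G.laplacian.PosSemidef := by
  refine .of_dotProduct_mulVec_nonneg G.isHermitian_laplacian fun x => ?_
  rw [star_trivial, G.dotProduct_laplacian]
  exact mul_nonneg (by norm_num) (sum_nonneg fun i _ => sum_nonneg fun j _ =>
    mul_nonneg (G.weight_nonneg i j) (mul_self_nonneg _))

variable {G}

theorem eq_of_adj_of_dotProduct_laplacian_eq_zero {x : V → ℝ}
    (hx : x ⬝ᵥ (G.laplacian *ᵥ x) = 0) {i j : V} (hij : G.graph.Adj i j) : x i = x j := by
  rw [G.dotProduct_laplacian, mul_eq_zero, or_iff_right (by norm_num)] at hx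
  have hterm : ∀ i j, 0 ≤ G.weight i j * ((x i - x j) * (x i - x j)) := fun i j =>
    mul_nonneg (G.weight_nonneg i j) (mul_self_nonneg _)
  have hrow := (sum_eq_zero_iff_of_nonneg fun i _ => sum_nonneg fun j _ => hterm i j).1 hx i
    (mem_univ i)
  have hedge := (sum_eq_zero_iff_of_nonneg fun j _ => hterm i j).1 hrow j (mem_univ j)
  simpa [(G.weight_pos i j hij).ne', sub_eq_zero] using hedge

theorem eq_of_dotProduct_laplacian_eq_zero (hG : G.graph.Connected) {x : V → ℝ}
    (hx : x ⬝ᵥ (G.laplacian *ᵥ x) = 0) (i j : V) : x i = x j := by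
  obtain ⟨p⟩ := hG.preconnected i j
  induction p with
  | nil => rfl
  | cons h _ ih => exact (eq_of_adj_of_dotProduct_laplacian_eq_zero hx h).trans ih

theorem IsSpectralGap.pos {l : ℝ} (hl : G.IsSpectralGap l) : 0 < l := by
  obtain ⟨x, hx⟩ := hl.1.2.exists_hasEigenvector
  have hmul : G.laplacian *ᵥ x = l • x := Module.End.mem_eigenspace_iff.1 hx.1
  have henergy := G.posSemidef_laplacian.dotProduct_mulVec_nonneg x
  rw [star_trivial, hmul, dotProduct_smul, smul_eq_mul] at henergy
  have hnorm : 0 < x ⬝ᵥ x := by simpa using dotProduct_star_self_pos_iff.2 hx.2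
  exact (nonneg_of_mul_nonneg_left henergy hnorm).lt_of_ne' hl.1.1

theorem IsSpectralGap.mul_dotProduct_self_le (hG : G.graph.Connected) {l : ℝ}
    (hl : G.IsSpectralGap l) {x : V → ℝ} (hx : ∑ i, x i = 0) :
    l * (x ⬝ᵥ x) ≤ x ⬝ᵥ (G.laplacian *ᵥ x) := by
  refine mul_dotProduct_self_le_of_le_eigenvalues G.isHermitian_laplacian
    (fun t ht ht' => hl.2 ⟨ht, ht'⟩) fun y hy => ?_
  obtain ⟨i₀⟩ := hG.nonempty
  have hconst := eq_of_dotProduct_laplacian_eq_zero hG (x := y) (by rw [hy, dotProduct_zero])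
  simp only [dotProduct, hconst _ i₀, ← mul_sum, hx, mul_zero]

theorem IsSpectralGap.mul_sub_sq_le (hG : G.graph.Connected) {l : ℝ} (hl : G.IsSpectralGap l)
    (x : V → ℝ) (v w : V) : l * (x v - x w) ^ 2 ≤ 2 * (x ⬝ᵥ (G.laplacian *ᵥ x)) := by
  rcases eq_or_ne v w with rfl | hvw
  · simpa using G.posSemidef_laplacian.dotProduct_mulVec_nonneg x
  have := hG.nonempty
  set a : ℝ := (∑ i, x i) / Fintype.card V with ha
  have hmean : ∑ i, (x i - a) = 0 := by
    rw [sum_sub_distrib, sum_const, card_univ, nsmul_eq_mul, ha]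
    field_simp
    ring
  have hpoincare := hl.mul_dotProduct_self_le hG hmean
  simp only [G.dotProduct_laplacian, sub_sub_sub_cancel_right] at hpoincare
  rw [← G.dotProduct_laplacian] at hpoincare
  have hpair : (x v - a) ^ 2 + (x w - a) ^ 2 ≤ (fun i => x i - a) ⬝ᵥ fun i => x i - a := by
    simp only [dotProduct, ← sq]
    rw [← sum_pair hvw (f := fun i => (x i - a) ^ 2)]
    exact sum_le_sum_of_subset_of_nonneg (subset_univ _) fun _ _ _ => sq_nonneg _
  have hsub : (x v - x w) ^ 2 ≤ 2 * ((x v - a) ^ 2 + (x w - a) ^ 2) := by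
    nlinarith [sq_nonneg ((x v - a) + (x w - a))]
  nlinarith [hl.pos]

end Laplacian

section Green

variable {V : Type*} [Fintype V] [DecidableEq V] (G : WeightedGraph V)

/-- The operator `n + c L` whose inverse propagates labels over the graph when the vertex `i`
carries `n i` labels; it is invertible although the Laplacian `L` is not. -/
noncomputable def screened (c : ℝ) (n : V → ℝ) : Matrix V V ℝ :=
  diagonal n + c • G.laplacian

variable {G} {c : ℝ} {n : V → ℝ}

theorem screened_mulVec (x : V → ℝ) (i : V) :
    (G.screened c n *ᵥ x) i = n i * x i + c * (G.laplacian *ᵥ x) i := by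
  simp [screened, add_mulVec, mulVec_diagonal, smul_mulVec]

theorem screened_mulVec_const (a : ℝ) (i : V) : (G.screened c n *ᵥ fun _ => a) i = n i * a := by
  simp [screened_mulVec, laplacian_mulVec]

theorem dotProduct_screened (y x : V → ℝ) :
    y ⬝ᵥ (G.screened c n *ᵥ x) = ∑ i, n i * (y i * x i) + c * (y ⬝ᵥ (G.laplacian *ᵥ x)) := by
  simp only [dotProduct, screened_mulVec, mul_add, sum_add_distrib, mul_sum, mul_left_comm]

theorem dotProduct_screened_comm (y x : V → ℝ) :
    y ⬝ᵥ (G.screened c n *ᵥ x) = x ⬝ᵥ (G.screened c n *ᵥ y) := by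
  simp only [dotProduct_screened, dotProduct_laplacian, mul_comm (y _), mul_comm (y _ - y _)]

theorem screened_add_single_mulVec (a : ℝ) (v : V) (x : V → ℝ) :
    G.screened c (n + Pi.single v a) *ᵥ x = G.screened c n *ᵥ x + Pi.single v (a * x v) := by
  ext i
  rcases eq_or_ne i v with rfl | hi
  · simp only [screened_mulVec, Pi.add_apply, Pi.single_eq_same]
    ring
  · simp only [screened_mulVec, Pi.add_apply, Pi.single_eq_of_ne hi, add_zero]

theorem posDef_screened (hG : G.graph.Connected) (hc : 0 < c) (hn : 0 < n) :
    (G.screened c n).PosDef := by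
  have hdiag : (diagonal n).PosSemidef := PosSemidef.diagonal hn.le
  refine .of_dotProduct_mulVec_pos
    (hdiag.add (G.posSemidef_laplacian.smul hc.le)).isHermitian fun x hx => ?_
  rw [star_trivial, dotProduct_screened]
  have hmass : ∀ i, 0 ≤ n i * (x i * x i) := fun i => mul_nonneg (hn.le i) (mul_self_nonneg _)
  have henergy : 0 ≤ x ⬝ᵥ (G.laplacian *ᵥ x) := by
    simpa using G.posSemidef_laplacian.dotProduct_mulVec_nonneg x
  rcases henergy.eq_or_lt' with hzero | hpos
  · obtain ⟨v, hv⟩ := (Pi.lt_def.1 hn).2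
    have hconst := eq_of_dotProduct_laplacian_eq_zero hG hzero
    have hxv : x v ≠ 0 := fun h => hx (funext fun i => (hconst i v).trans h)
    rw [hzero, mul_zero, add_zero]
    exact sum_pos' (fun i _ => hmass i) ⟨v, mem_univ v, mul_pos hv (mul_self_pos.2 hxv)⟩
  · exact add_pos_of_nonneg_of_pos (sum_nonneg fun i _ => hmass i) (mul_pos hc hpos)

theorem screened_mulVec_inv_mulVec (hG : G.graph.Connected) (hc : 0 < c) (hn : 0 < n)
    (b : V → ℝ) : G.screened c n *ᵥ ((G.screened c n)⁻¹ *ᵥ b) = b := by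
  rw [mulVec_mulVec, mul_nonsing_inv _ ((isUnit_iff_isUnit_det _).1
    (posDef_screened hG hc hn).isUnit), one_mulVec]

theorem inf_zero_dotProduct_screened_inf_zero_le (hc : 0 ≤ c) (hn : 0 ≤ n) (x : V → ℝ) :
    (x ⊓ 0) ⬝ᵥ (G.screened c n *ᵥ (x ⊓ 0)) ≤ (x ⊓ 0) ⬝ᵥ (G.screened c n *ᵥ x) := by
  have hmass : ∀ a : ℝ, (a ⊓ 0) * (a ⊓ 0) ≤ (a ⊓ 0) * a := fun a => by
    rcases le_total a 0 with h | h <;> simp [h]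
  have henergy : ∀ a b : ℝ,
      (a ⊓ 0 - b ⊓ 0) * (a ⊓ 0 - b ⊓ 0) ≤ (a ⊓ 0 - b ⊓ 0) * (a - b) := fun a b => by
    rcases le_total a 0 with ha | ha <;> rcases le_total b 0 with hb | hb <;>
      simp only [inf_of_le_left, inf_of_le_right, ha, hb] <;> nlinarith
  simp only [dotProduct_screened, dotProduct_laplacian, Pi.inf_apply, Pi.zero_apply]
  refine add_le_add (sum_le_sum fun i _ => mul_le_mul_of_nonneg_left (hmass _) (hn i))
    (mul_le_mul_of_nonneg_left (mul_le_mul_of_nonneg_left ?_ (by norm_num)) hc)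
  exact sum_le_sum fun i _ => sum_le_sum fun j _ =>
    mul_le_mul_of_nonneg_left (henergy _ _) (G.weight_nonneg i j)

theorem nonneg_of_screened (hG : G.graph.Connected) (hc : 0 < c) (hn : 0 < n) {x : V → ℝ}
    (hx : ∀ i, 0 ≤ x i ∨ 0 ≤ (G.screened c n *ᵥ x) i) : 0 ≤ x := by
  have hnonpos : (x ⊓ 0) ⬝ᵥ (G.screened c n *ᵥ x) ≤ 0 := by
    refine sum_nonpos fun i _ => ?_
    rcases hx i with h | h
    · simp [h]
    · exact mul_nonpos_of_nonpos_of_nonneg (min_le_right _ _) h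
  by_contra hneg
  refine ((posDef_screened hG hc hn).dotProduct_mulVec_pos fun h => hneg ?_).not_ge
    ((inf_zero_dotProduct_screened_inf_zero_le hc.le hn.le x).trans hnonpos)
  exact inf_eq_right.1 h

theorem abs_le_of_screened (hG : G.graph.Connected) (hc : 0 < c) (hn : 0 < n) {x : V → ℝ} {a : ℝ}
    (hx : ∀ i, |x i| ≤ a ∨ |(G.screened c n *ᵥ x) i| ≤ n i * a) (i : V) : |x i| ≤ a := by
  have hupper : 0 ≤ (fun _ => a) - x := nonneg_of_screened hG hc hn fun i => by
    simp only [mulVec_sub, Pi.sub_apply, screened_mulVec_const, sub_nonneg]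
    exact (hx i).imp le_of_abs_le le_of_abs_le
  have hlower : 0 ≤ (fun _ => a) + x := nonneg_of_screened hG hc hn fun i => by
    simp only [mulVec_add, Pi.add_apply, screened_mulVec_const, ← neg_le_iff_add_nonneg']
    exact (hx i).imp neg_le_of_abs_le neg_le_of_abs_le
  exact abs_le.2 ⟨neg_le_iff_add_nonneg'.2 (hlower i), sub_nonneg.1 (hupper i)⟩

theorem sq_apply_le_mul_dotProduct_screened (hG : G.graph.Connected) (hc : 0 < c) (hn : 0 < n)
    {l : ℝ} (hl : G.IsSpectralGap l) (x : V → ℝ) (v : V) :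
    x v ^ 2 ≤ (1 / ∑ i, n i + 2 / (c * l)) * (x ⬝ᵥ (G.screened c n *ᵥ x)) := by
  set N := ∑ i, n i with hN
  set κ := 1 / N + 2 / (c * l) with hκ
  set e := c * (x ⬝ᵥ (G.laplacian *ᵥ x))
  have hNpos : 0 < N := Fintype.sum_pos hn
  have hlpos := hl.pos
  have hpointwise : ∀ i, x v ^ 2 ≤ κ * (N * x i ^ 2 + e) := by
    intro i
    have hcauchy : x v ^ 2 ≤ κ * (N * x i ^ 2 + c * l / 2 * (x v - x i) ^ 2) := by
      have hsq : κ * (N * x i ^ 2 + c * l / 2 * (x v - x i) ^ 2) - x v ^ 2 =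
          (2 * N * x i - c * l * (x v - x i)) ^ 2 / (2 * N * (c * l)) := by
        rw [hκ]
        field_simp
        ring
      rw [← sub_nonneg, hsq]
      positivity
    refine hcauchy.trans (mul_le_mul_of_nonneg_left ?_ (by positivity))
    nlinarith [hl.mul_sub_sq_le hG x v i]
  refine le_of_mul_le_mul_left ?_ hNpos
  calc N * x v ^ 2 = ∑ i, n i * x v ^ 2 := by rw [hN, sum_mul]
    _ ≤ ∑ i, n i * (κ * (N * x i ^ 2 + e)) :=
        sum_le_sum fun i _ => mul_le_mul_of_nonneg_left (hpointwise i) (hn.le i)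
    _ = κ * N * ∑ i, n i * (x i * x i) + N * (κ * e) := by
        rw [hN, sum_mul, mul_sum, ← sum_add_distrib]
        exact sum_congr rfl fun i _ => by ring
    _ = N * (κ * (x ⬝ᵥ (G.screened c n *ᵥ x))) := by
        rw [dotProduct_screened]
        ring

theorem inv_screened_apply_self_le (hG : G.graph.Connected) (hc : 0 < c) (hn : 0 < n) {l : ℝ}
    (hl : G.IsSpectralGap l) (v : V) :
    (G.screened c n)⁻¹ v v ≤ 1 / ∑ i, n i + 2 / (c * l) := by
  set k := (G.screened c n)⁻¹ *ᵥ Pi.single v 1 with hk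
  have hkv : (G.screened c n)⁻¹ v v = k v := by simp [hk]
  have hbound := sq_apply_le_mul_dotProduct_screened hG hc hn hl k v
  rw [hk, screened_mulVec_inv_mulVec hG hc hn, ← hk, dotProduct_single, mul_one] at hbound
  have hNpos : 0 < ∑ i, n i := Fintype.sum_pos hn
  have hlpos := hl.pos
  rw [hkv]
  by_contra! hlt
  have hkpos : 0 < k v := lt_trans (by positivity) hlt
  nlinarith

-- The screened equations of `x` and `x₀` differ only at `v`, and `x - (1 - k) x₀`, with `k` the
-- diagonal entry of the Green function, takes the value `k y` there.
theorem abs_sub_mul_le_of_add_label (hG : G.graph.Connected) (hc : 0 < c) (hn : 0 < n)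
    {x x₀ b : V → ℝ} {a y κ : ℝ} {v : V} (hx₀ : G.screened c n *ᵥ x₀ = b)
    (hb : ∀ i, |b i| ≤ n i * a) (hy : |y| ≤ a)
    (hx : G.screened c (n + Pi.single v 1) *ᵥ x = b + Pi.single v y)
    (hκ : (G.screened c (n + Pi.single v 1))⁻¹ v v ≤ κ) (i : V) :
    |x i - (1 - κ) * x₀ i| ≤ κ * a := by
  have hn' : 0 < n + Pi.single v 1 :=
    add_pos_of_pos_of_nonneg hn (Pi.single_nonneg.2 zero_le_one)
  set k := (G.screened c (n + Pi.single v 1))⁻¹ v v with hk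
  have hk0 : 0 ≤ k := (posDef_screened hG hc hn').inv.posSemidef.diag_nonneg
  have hx₀' : G.screened c (n + Pi.single v 1) *ᵥ x₀ = b + Pi.single v (x₀ v) := by
    rw [screened_add_single_mulVec, hx₀, one_mul]
  have hxv : x v - x₀ v = (y - x₀ v) * k := by
    have hgreen := dotProduct_screened_comm (G := G) (c := c) (n := n + Pi.single v 1) (x - x₀)
      ((G.screened c (n + Pi.single v 1))⁻¹ *ᵥ Pi.single v 1)
    rw [screened_mulVec_inv_mulVec hG hc hn', mulVec_sub, hx, hx₀', add_sub_add_left_eq_sub,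
      ← Pi.single_sub, dotProduct_single, dotProduct_single] at hgreen
    simpa [hk, mul_comm] using hgreen
  have hdiff : ∀ i, |(x - (1 - k) • x₀) i| ≤ k * a := by
    refine abs_le_of_screened hG hc hn' fun i => ?_
    rcases eq_or_ne i v with rfl | hi
    · left
      have hvalue : x i - (1 - k) * x₀ i = k * y := by linear_combination hxv
      rw [Pi.sub_apply, Pi.smul_apply, smul_eq_mul, hvalue, abs_mul, abs_of_nonneg hk0]
      exact mul_le_mul_of_nonneg_left hy hk0
    · right
      have hvalue : b i - (1 - k) * b i = k * b i := by ring
      simp only [mulVec_sub, mulVec_smul, hx, hx₀', Pi.sub_apply, Pi.smul_apply, Pi.add_apply,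
        Pi.single_eq_of_ne hi, add_zero, smul_eq_mul, hvalue, abs_mul, abs_of_nonneg hk0]
      nlinarith [hb i]
  have hx₀a : |x₀ i| ≤ a := abs_le_of_screened hG hc hn (fun i => .inr (hx₀ ▸ hb i)) i
  calc |x i - (1 - κ) * x₀ i| = |(x - (1 - k) • x₀) i + (κ - k) * x₀ i| := by
        congr 1
        simp only [Pi.sub_apply, Pi.smul_apply, smul_eq_mul]
        ring
    _ ≤ k * a + (κ - k) * a := by
        refine (abs_add_le _ _).trans (add_le_add (hdiff i) ?_)
        rw [abs_mul, abs_of_nonneg (sub_nonneg.2 hκ)]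
        exact mul_le_mul_of_nonneg_left hx₀a (sub_nonneg.2 hκ)
    _ = κ * a := by ring

end Green

end WeightedGraph

section BoundedDifferences

open ProbabilityTheory

theorem abs_integral_le_of_abs_le {α : Type*} [MeasurableSpace α] (μ : Measure α)
    [IsProbabilityMeasure μ] {f : α → ℝ} {C : ℝ} (h : ∀ x, |f x| ≤ C) : |∫ x, f x ∂μ| ≤ C := by
  simpa using norm_integral_le_of_norm_le_const (μ := μ) (f := f) (ae_of_all _ h)

theorem hasSubgaussianMGF_sub_integral_of_abs_sub_le {α : Type*} [MeasurableSpace α]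
    {μ : Measure α} [IsProbabilityMeasure μ] {f : α → ℝ} {c : ℝ} (hf : AEMeasurable f μ)
    (hc : ∀ x y, |f x - f y| ≤ c) :
    HasSubgaussianMGF (fun x => f x - ∫ y, f y ∂μ) ((‖c‖₊ / 2) ^ 2) μ := by
  have : Nonempty α := nonempty_of_isProbabilityMeasure μ
  have hlower : ∀ x y, f x - c ≤ f y := fun x y => by linarith [le_of_abs_le (hc x y)]
  have hIcc : ∀ x, f x ∈ Set.Icc (⨅ y, f y) ((⨅ y, f y) + c) := fun x =>
    ⟨ciInf_le ⟨f x - c, Set.forall_mem_range.2 (hlower x)⟩ x,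
      sub_le_iff_le_add.1 (le_ciInf (hlower x))⟩
  simpa using hasSubgaussianMGF_of_mem_Icc hf (ae_of_all _ hIcc)

theorem hasSubgaussianMGF_prod {α β : Type*} [MeasurableSpace α] [MeasurableSpace β]
    {μ : Measure α} {ν : Measure β} [IsProbabilityMeasure μ] [IsProbabilityMeasure ν] {X : α → ℝ}
    {Y : α × β → ℝ} {a b : NNReal} (hX : HasSubgaussianMGF X a μ) (hYm : Measurable Y)
    (hY : ∀ x, HasSubgaussianMGF (fun y => Y (x, y)) b ν) :
    HasSubgaussianMGF (fun p => X p.1 + Y p) (a + b) (μ.prod ν) := by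
  have hfactor : ∀ t x y, Real.exp (t * (X x + Y (x, y))) =
      Real.exp (t * X x) * Real.exp (t * Y (x, y)) := fun t x y => by rw [mul_add, Real.exp_add]
  have hinner : ∀ t x, ∫ y, Real.exp (t * (X x + Y (x, y))) ∂ν ≤
      Real.exp (t * X x) * Real.exp (b * t ^ 2 / 2) := fun t x => by
    simp only [hfactor, integral_const_mul]
    exact mul_le_mul_of_nonneg_left ((hY x).mgf_le t) (Real.exp_pos _).le
  have hbound : ∀ t, Integrable (fun x => Real.exp (t * X x) * Real.exp (b * t ^ 2 / 2)) μ :=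
    fun t => (hX.integrable_exp_mul t).mul_const _
  have hint : ∀ t, Integrable (fun p : α × β => Real.exp (t * (X p.1 + Y p))) (μ.prod ν) := by
    intro t
    have hmeas : AEStronglyMeasurable (fun p : α × β => Real.exp (t * (X p.1 + Y p)))
        (μ.prod ν) :=
      ((hX.aemeasurable.comp_fst.add hYm.aemeasurable).const_mul t).exp.aestronglyMeasurable
    refine (integrable_prod_iff hmeas).2 ⟨ae_of_all _ fun x => ?_,
      (hbound t).mono' hmeas.norm.integral_prod_right' (ae_of_all _ fun x => ?_)⟩
    · simpa only [hfactor] using ((hY x).integrable_exp_mul t).const_mul _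
    · have hnonneg : 0 ≤ ∫ y, Real.exp (t * (X x + Y (x, y))) ∂ν :=
        integral_nonneg fun y => (Real.exp_pos _).le
      simpa only [Real.norm_eq_abs, Real.abs_exp, abs_of_nonneg hnonneg] using hinner t x
  refine ⟨hint, fun t => ?_⟩
  calc mgf (fun p => X p.1 + Y p) (μ.prod ν) t
      = ∫ x, ∫ y, Real.exp (t * (X x + Y (x, y))) ∂ν ∂μ := integral_prod _ (hint t)
    _ ≤ ∫ x, Real.exp (t * X x) * Real.exp (b * t ^ 2 / 2) ∂μ :=
        integral_mono (hint t).integral_prod_left (hbound t) (hinner t)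
    _ ≤ Real.exp (a * t ^ 2 / 2) * Real.exp (b * t ^ 2 / 2) := by
        rw [integral_mul_const]
        exact mul_le_mul_of_nonneg_right (hX.mgf_le t) (Real.exp_pos _).le
    _ = Real.exp ((a + b : NNReal) * t ^ 2 / 2) := by
        rw [← Real.exp_add]
        push_cast
        ring_nf

-- The martingale decomposition `G - ∫ G = (g - ∫ g) + (G - g)` with `g` the conditional mean of
-- `G`; Hoeffding's lemma applies to the first summand.
theorem hasSubgaussianMGF_sub_integral_prod {α β : Type*} [MeasurableSpace α] [MeasurableSpace β]
    {μ : Measure α} {ν : Measure β} [IsProbabilityMeasure μ] [IsProbabilityMeasure ν]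
    {G : α × β → ℝ} {c : ℝ} {b : NNReal} (hGm : Measurable G) (hG : Integrable G (μ.prod ν))
    (hc : ∀ x x' y, |G (x, y) - G (x', y)| ≤ c)
    (hb : ∀ x, HasSubgaussianMGF (fun y => G (x, y) - ∫ y', G (x, y') ∂ν) b ν) :
    HasSubgaussianMGF (fun p => G p - ∫ q, G q ∂μ.prod ν) ((‖c‖₊ / 2) ^ 2 + b) (μ.prod ν) := by
  set g : α → ℝ := fun x => ∫ y, G (x, y) ∂ν with hg
  have hgm : Measurable g := hGm.stronglyMeasurable.integral_prod_right'.measurable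
  have hint : ∀ x, Integrable (fun y => G (x, y)) ν := fun x => by
    simpa only [hg, sub_add_cancel, Pi.add_def] using (hb x).integrable.add (integrable_const (g x))
  have hmean : HasSubgaussianMGF (fun x => g x - ∫ x', g x' ∂μ) ((‖c‖₊ / 2) ^ 2) μ := by
    refine hasSubgaussianMGF_sub_integral_of_abs_sub_le hgm.aemeasurable fun x x' => ?_
    rw [hg, ← integral_sub (hint x) (hint x')]
    exact abs_integral_le_of_abs_le ν (hc x x')
  have hsum := hasSubgaussianMGF_prod (Y := fun p => G p - g p.1) hmean
    (hGm.sub (hgm.comp measurable_fst)) hb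
  rw [integral_prod G hG]
  simpa only [sub_add_sub_cancel'] using hsum

theorem integrable_of_abs_sub_le {α : Type*} [MeasurableSpace α] {μ : Measure α}
    [IsProbabilityMeasure μ] {f : α → ℝ} {c : ℝ} (hf : AEMeasurable f μ)
    (hc : ∀ x y, |f x - f y| ≤ c) : Integrable f μ := by
  obtain ⟨x₀⟩ : Nonempty α := nonempty_of_isProbabilityMeasure μ
  refine .of_mem_Icc (f x₀ - c) (f x₀ + c) hf (ae_of_all _ fun x => ?_)
  exact abs_sub_le_iff.1 (hc x x₀) |>.symm.imp (fun h => by linarith) fun h => by linarith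

theorem abs_sub_le_sum_of_abs_update_sub_le {ι : Type*} [Fintype ι] [DecidableEq ι]
    {Z : ι → Type*} {F : (∀ i, Z i) → ℝ} {c : ι → ℝ}
    (hF : ∀ S i z, |F (Function.update S i z) - F S| ≤ c i) (S S' : ∀ i, Z i) :
    |F S - F S'| ≤ ∑ i, c i := by
  have hpartial : ∀ s : Finset ι, |F (s.piecewise S S') - F S'| ≤ ∑ i ∈ s, c i := fun s => by
    induction s using Finset.induction_on with
    | empty => simp
    | insert i s hi ih =>
      rw [Finset.piecewise_insert, Finset.sum_insert hi]
      exact (abs_sub_le _ _ _).trans (add_le_add (hF _ _ _) ih)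
  simpa using hpartial Finset.univ

theorem hasSubgaussianMGF_sub_integral_of_bounded_differences {n : ℕ} {Z : Fin n → Type*}
    [∀ i, MeasurableSpace (Z i)] (μ : ∀ i, Measure (Z i)) [∀ i, IsProbabilityMeasure (μ i)]
    {F : (∀ i, Z i) → ℝ} {c : Fin n → ℝ} (hFm : Measurable F)
    (hF : ∀ S i z, |F (Function.update S i z) - F S| ≤ c i) :
    HasSubgaussianMGF (fun S => F S - ∫ S', F S' ∂Measure.pi μ) (∑ i, (‖c i‖₊ / 2) ^ 2)
      (Measure.pi μ) := by
  induction n with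
  | zero =>
    have hconst : ∀ S, F S = F default := fun S => congrArg F (Subsingleton.elim _ _)
    simp only [hconst, integral_const, probReal_univ, one_smul, sub_self, Finset.univ_eq_empty,
      Finset.sum_empty]
    exact .fun_zero
  | succ n ih =>
    have hmp := measurePreserving_piFinSuccAbove μ 0
    set e := MeasurableEquiv.piFinSuccAbove Z 0
    set G : Z 0 × (∀ j, Z ((0 : Fin (n + 1)).succAbove j)) → ℝ :=
      fun p => F (Fin.insertNth 0 p.1 p.2) with hG
    have hGm : Measurable G := hFm.comp e.symm.measurable
    have hGe : ∀ S, G (e S) = F S := fun S => congrArg F (e.symm_apply_apply S)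
    have hprod := hasSubgaussianMGF_sub_integral_prod (μ := μ 0) hGm
      (integrable_of_abs_sub_le hGm.aemeasurable fun p q =>
        abs_sub_le_sum_of_abs_update_sub_le hF _ _)
      (c := c 0) (fun z z' S => by
        simp only [hG, ← Fin.update_insertNth 0 z' z]
        exact hF _ _ _)
      (fun z => ih (fun j => μ (Fin.succAbove 0 j)) (hGm.comp measurable_prodMk_left)
        fun S j w => by
          simp only [hG, Fin.insertNth_update]
          exact hF _ _ _)
    rw [← hmp.integral_comp', ← hmp.map_eq] at hprod
    rw [Fin.sum_univ_succAbove _ 0]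
    simpa only [Function.comp_def, hGe] using hprod.of_map hmp.measurable.aemeasurable

theorem measure_abs_sub_integral_ge_le {n : ℕ} {Z : Fin n → Type*} [∀ i, MeasurableSpace (Z i)]
    (μ : ∀ i, Measure (Z i)) [∀ i, IsProbabilityMeasure (μ i)] {F : (∀ i, Z i) → ℝ}
    {c : Fin n → ℝ} (hFm : Measurable F) (hF : ∀ S i z, |F (Function.update S i z) - F S| ≤ c i)
    {ε : ℝ} (hε : 0 ≤ ε) :
    Measure.pi μ {S | ε ≤ |F S - ∫ S', F S' ∂Measure.pi μ|} ≤
      ENNReal.ofReal (2 * Real.exp (-(2 * ε ^ 2 / ∑ i, c i ^ 2))) := by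
  set P := Measure.pi μ
  set X := fun S => F S - ∫ S', F S' ∂P
  have hsub := hasSubgaussianMGF_sub_integral_of_bounded_differences μ hFm hF
  have hrate : -ε ^ 2 / (2 * (∑ i, (‖c i‖₊ / 2) ^ 2 : NNReal)) = -(2 * ε ^ 2 / ∑ i, c i ^ 2) := by
    have hvar : 2 * ((∑ i, (‖c i‖₊ / 2) ^ 2 : NNReal) : ℝ) = (∑ i, c i ^ 2) / 2 := by
      push_cast
      simp only [div_pow, Real.norm_eq_abs, sq_abs, ← Finset.sum_div]
      ring
    rw [hvar, neg_div, div_div_eq_mul_div, mul_comm]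
  have hunion : {S | ε ≤ |X S|} = {S | ε ≤ X S} ∪ {S | ε ≤ (-X) S} := by
    ext S
    simp only [Set.mem_union, Set.mem_ofPred_eq, Pi.neg_apply, le_abs]
  refine (ENNReal.le_ofReal_iff_toReal_le (measure_ne_top _ _) (by positivity)).2 ?_
  calc P.real {S | ε ≤ |X S|} ≤ P.real {S | ε ≤ X S} + P.real {S | ε ≤ (-X) S} :=
        hunion ▸ measureReal_union_le _ _
    _ ≤ 2 * Real.exp (-(2 * ε ^ 2 / ∑ i, c i ^ 2)) := by
        rw [two_mul, ← hrate]
        exact add_le_add (hsub.measure_ge_le hε) (hsub.neg.measure_ge_le hε)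

end BoundedDifferences

section Resampling

theorem measurePreserving_update {ι : Type*} [Fintype ι] [DecidableEq ι] {Z : ι → Type*}
    [∀ i, MeasurableSpace (Z i)] (μ : ∀ i, Measure (Z i)) [∀ i, IsProbabilityMeasure (μ i)]
    (i : ι) :
    MeasurePreserving (fun p : (∀ j, Z j) × Z i => Function.update p.1 i p.2)
      ((Measure.pi μ).prod (μ i)) (Measure.pi μ) := by
  refine ⟨measurable_update', (Measure.pi_eq fun s hs => ?_).symm⟩
  have hpreimage : (fun p : (∀ j, Z j) × Z i => Function.update p.1 i p.2) ⁻¹' Set.univ.pi s =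
      Set.univ.pi (Function.update s i Set.univ) ×ˢ s i := by
    ext p
    simp only [Set.mem_preimage, Set.mem_univ_pi, Set.mem_prod]
    rw [Function.forall_update_iff p.1 fun j z => z ∈ s j,
      Function.forall_update_iff s fun j t => p.1 j ∈ t]
    simp [and_comm]
  rw [Measure.map_apply measurable_update' (.univ_pi hs), hpreimage, Measure.prod_prod,
    Measure.pi_pi, ← Finset.mul_prod_erase _ _ (Finset.mem_univ i),
    ← Finset.mul_prod_erase _ (fun j => μ j (s j)) (Finset.mem_univ i), Function.update_self,
    measure_univ, one_mul, mul_comm]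
  congr 1
  exact Finset.prod_congr rfl fun j hj => by rw [Function.update_of_ne (Finset.ne_of_mem_erase hj)]

end Resampling

section Stability

variable {Z : Type*} [MeasurableSpace Z] {m : ℕ}

/-- The expected minus the empirical cost of a learning algorithm, where `c S z` is the cost at `z`
of the hypothesis that the algorithm produces from the training set `S`. -/
noncomputable def generalizationGap (D : Measure Z) (c : (Fin m → Z) → Z → ℝ)
    (S : Fin m → Z) : ℝ :=
  ∫ z, c S z ∂D - (m : ℝ)⁻¹ * ∑ i, c S (S i)

/-- A jointly measurable cost with values in `[0, M]` that changes by at most `β` when one training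
sample is replaced: replace-one uniform stability of the learning algorithm. -/
structure UniformlyStable (c : (Fin m → Z) → Z → ℝ) (M β : ℝ) : Prop where
  measurable : Measurable (Function.uncurry c)
  nonneg : ∀ S z, 0 ≤ c S z
  le : ∀ S z, c S z ≤ M
  abs_update_sub_le : ∀ S i w z, |c (Function.update S i w) z - c S z| ≤ β

variable (D : Measure Z) {c : (Fin m → Z) → Z → ℝ} {M β : ℝ}

theorem measurable_cost_sample (hc : Measurable (Function.uncurry c)) (i : Fin m) :
    Measurable fun S => c S (S i) :=
  hc.comp (measurable_id.prodMk (measurable_pi_apply i))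

theorem measurable_integral_cost [SFinite D] (hc : Measurable (Function.uncurry c)) :
    Measurable fun S => ∫ z, c S z ∂D :=
  hc.stronglyMeasurable.integral_prod_right.measurable

theorem measurable_generalizationGap [SFinite D] (hc : Measurable (Function.uncurry c)) :
    Measurable (generalizationGap D c) :=
  (measurable_integral_cost D hc).sub
    ((Finset.measurable_sum _ fun i _ => measurable_cost_sample hc i).const_mul _)

theorem generalizationGap_eq_sum (hm : 0 < m) (S : Fin m → Z) :
    generalizationGap D c S = (m : ℝ)⁻¹ * ∑ i, (∫ z, c S z ∂D - c S (S i)) := by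
  have hm' : (m : ℝ) ≠ 0 := Nat.cast_ne_zero.2 hm.ne'
  rw [generalizationGap, Finset.sum_sub_distrib, mul_sub]
  simp [hm']

variable [IsProbabilityMeasure D]

-- The sample `S i` and a fresh sample are exchangeable, so that
-- `∫ c S (S i) = ∬ c (update S i z) z`.
theorem abs_integral_integral_sub_le {B K : ℝ} (hc : Measurable (Function.uncurry c))
    (hB : ∀ S z, |c S z| ≤ B) (i : Fin m)
    (hK : ∀ S z, |c S z - c (Function.update S i z) z| ≤ K) :
    |∫ S, (∫ z, c S z ∂D - c S (S i)) ∂Measure.pi fun _ => D| ≤ K := by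
  set P : Measure (Fin m → Z) := Measure.pi fun _ => D
  have hmp : MeasurePreserving _ (P.prod D) P := measurePreserving_update (fun _ => D) i
  have hsample : Integrable (fun S => c S (S i)) P :=
    .of_bound (measurable_cost_sample hc i).aestronglyMeasurable B (ae_of_all _ fun S => hB S _)
  have hrisk : Integrable (fun S => ∫ z, c S z ∂D) P :=
    .of_bound (measurable_integral_cost D hc).aestronglyMeasurable B
      (ae_of_all _ fun S => abs_integral_le_of_abs_le D (hB S))
  have hfresh : Integrable (fun p : (Fin m → Z) × Z => c p.1 p.2) (P.prod D) :=
    .of_bound hc.aestronglyMeasurable B (ae_of_all _ fun p => hB _ _)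
  have hresampled : Integrable (fun p : (Fin m → Z) × Z => c (Function.update p.1 i p.2) p.2)
      (P.prod D) := by
    simpa [Function.comp_def] using (hmp.integrable_comp hsample.aestronglyMeasurable).2 hsample
  have hswap : ∫ S, c S (S i) ∂P = ∫ p, c (Function.update p.1 i p.2) p.2 ∂P.prod D := by
    rw [← hmp.map_eq, integral_map hmp.measurable.aemeasurable
      (measurable_cost_sample hc i).aestronglyMeasurable]
    simp only [Function.update_self, hmp.map_eq]
  rw [integral_sub hrisk hsample, hswap, ← integral_prod (fun p => c p.1 p.2) hfresh,
    ← integral_sub hfresh hresampled]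
  exact abs_integral_le_of_abs_le (P.prod D) fun p => hK p.1 p.2

theorem abs_integral_generalizationGap_le (hm : 0 < m) {B K : ℝ}
    (hc : Measurable (Function.uncurry c)) (hB : ∀ S z, |c S z| ≤ B)
    (hK : ∀ S i z, |c S z - c (Function.update S i z) z| ≤ K) :
    |∫ S, generalizationGap D c S ∂Measure.pi fun _ => D| ≤ K := by
  have hint : ∀ i, Integrable (fun S => ∫ z, c S z ∂D - c S (S i)) (Measure.pi fun _ => D) :=
    fun i => .of_bound ((measurable_integral_cost D hc).sub
      (measurable_cost_sample hc i)).aestronglyMeasurable (B + B)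
      (ae_of_all _ fun S => (abs_sub _ _).trans
        (add_le_add (abs_integral_le_of_abs_le D (hB S)) (hB S _)))
  have hm' : (0 : ℝ) < m := Nat.cast_pos.2 hm
  simp only [generalizationGap_eq_sum D hm]
  rw [integral_const_mul, integral_finsetSum _ fun i _ => hint i, abs_mul,
    abs_of_pos (inv_pos.2 hm'), inv_mul_le_iff₀ hm']
  calc |∑ i, ∫ S, (∫ z, c S z ∂D - c S (S i)) ∂Measure.pi fun _ => D|
      ≤ ∑ i, |∫ S, (∫ z, c S z ∂D - c S (S i)) ∂Measure.pi fun _ => D| :=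
        Finset.abs_sum_le_sum_abs _ _
    _ ≤ ∑ _i : Fin m, K :=
        Finset.sum_le_sum fun i _ => abs_integral_integral_sub_le D hc hB i fun S => hK S i
    _ = m * K := by simp

namespace UniformlyStable

variable {D} (h : UniformlyStable c M β)
include h

theorem abs_le (S : Fin m → Z) (z : Z) : |c S z| ≤ M :=
  (abs_of_nonneg (h.nonneg S z)).trans_le (h.le S z)

theorem integrable (S : Fin m → Z) : Integrable (c S) D :=
  .of_bound (h.measurable.comp measurable_prodMk_left).aestronglyMeasurable M
    (ae_of_all _ (h.abs_le S))

theorem abs_generalizationGap_le (hm : 0 < m) (S : Fin m → Z) :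
    |generalizationGap D c S| ≤ M := by
  have hrisk : ∫ z, c S z ∂D ∈ Set.Icc 0 M :=
    ⟨integral_nonneg (h.nonneg S), le_of_abs_le (abs_integral_le_of_abs_le D (h.abs_le S))⟩
  have hemp : (m : ℝ)⁻¹ * ∑ i, c S (S i) ∈ Set.Icc 0 M := by
    refine ⟨mul_nonneg (by positivity) (Finset.sum_nonneg fun i _ => h.nonneg _ _), ?_⟩
    rw [inv_mul_le_iff₀ (Nat.cast_pos.2 hm)]
    simpa using Finset.sum_le_sum fun i (_ : i ∈ Finset.univ) => h.le S (S i)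
  exact abs_sub_le_of_nonneg_of_le hrisk.1 hrisk.2 hemp.1 hemp.2

theorem abs_sum_update_sub_le (S : Fin m → Z) (i : Fin m) (w : Z) :
    |∑ j, c (Function.update S i w) (Function.update S i w j) - ∑ j, c S (S j)| ≤
      m * β + M := by
  have hterm : ∀ j, |c (Function.update S i w) (Function.update S i w j) - c S (S j)| ≤
      β + if j = i then M else 0 := fun j => by
    rcases eq_or_ne j i with rfl | hj
    · rw [if_pos rfl]
      exact (abs_sub_le_of_nonneg_of_le (h.nonneg _ _) (h.le _ _) (h.nonneg _ _) (h.le _ _)).trans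
        (le_add_of_nonneg_left ((abs_nonneg _).trans (h.abs_update_sub_le S j w w)))
    · rw [Function.update_of_ne hj, if_neg hj, add_zero]
      exact h.abs_update_sub_le _ _ _ _
  rw [← Finset.sum_sub_distrib]
  refine (Finset.abs_sum_le_sum_abs _ _).trans ((Finset.sum_le_sum fun j _ => hterm j).trans_eq ?_)
  simp [Finset.sum_add_distrib]

theorem abs_generalizationGap_update_sub_le (hm : 0 < m) (S : Fin m → Z) (i : Fin m) (w : Z) :
    |generalizationGap D c (Function.update S i w) - generalizationGap D c S| ≤
      2 * β + M / m := by
  have hm' : (0 : ℝ) < m := Nat.cast_pos.2 hm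
  have hrisk : |∫ z, c (Function.update S i w) z ∂D - ∫ z, c S z ∂D| ≤ β := by
    rw [← integral_sub (h.integrable _) (h.integrable _)]
    exact abs_integral_le_of_abs_le D (h.abs_update_sub_le S i w)
  have hemp : |(m : ℝ)⁻¹ * (∑ j, c (Function.update S i w) (Function.update S i w j) -
      ∑ j, c S (S j))| ≤ β + M / m := by
    rw [abs_mul, abs_of_pos (inv_pos.2 hm'), inv_mul_le_iff₀ hm']
    refine (h.abs_sum_update_sub_le S i w).trans_eq ?_
    field_simp
  rw [generalizationGap, generalizationGap, sub_sub_sub_comm, ← mul_sub]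
  exact (abs_sub _ _).trans ((add_le_add hrisk hemp).trans_eq (by ring))

theorem abs_integral_generalizationGap_le (hm : 0 < m) :
    |∫ S, generalizationGap D c S ∂Measure.pi fun _ => D| ≤ β :=
  SoftLabel.abs_integral_generalizationGap_le D hm h.measurable h.abs_le fun S i z => by
    rw [abs_sub_comm]
    exact h.abs_update_sub_le S i z z

-- The square of the gap is the gap of the cost multiplied by the gap, to which the resampling bound
-- for the mean applies.
theorem integral_sq_generalizationGap_le (hm : 0 < m) :
    ∫ S, generalizationGap D c S ^ 2 ∂(Measure.pi fun _ => D) ≤ 3 * M * β + M ^ 2 / m := by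
  set g := generalizationGap D c
  have hsq : ∀ S, g S ^ 2 = generalizationGap D (fun S z => g S * c S z) S := fun S => by
    rw [generalizationGap, integral_const_mul, ← Finset.mul_sum, sq]
    change g S * generalizationGap D c S = _
    rw [generalizationGap]
    ring
  simp only [hsq]
  refine le_of_abs_le (SoftLabel.abs_integral_generalizationGap_le D hm
    (((measurable_generalizationGap D h.measurable).comp measurable_fst).mul h.measurable)
    (B := M * M) (fun S z => ?_) fun S i z => ?_)
  · rw [abs_mul]
    have hg : |g S| ≤ M := h.abs_generalizationGap_le hm S
    exact mul_le_mul hg (h.abs_le S z) (abs_nonneg _) ((abs_nonneg _).trans hg)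
  · set S' := Function.update S i z
    have hg : |g S| ≤ M := h.abs_generalizationGap_le hm S
    have hg' : |g S' - g S| ≤ 2 * β + M / m := h.abs_generalizationGap_update_sub_le hm S i z
    have hsplit : g S * c S z - g S' * c S' z =
        -(g S * (c S' z - c S z)) - (g S' - g S) * c S' z := by ring
    calc |g S * c S z - g S' * c S' z| ≤ |g S| * |c S' z - c S z| + |g S' - g S| * |c S' z| := by
          rw [hsplit, ← abs_mul, ← abs_mul, ← abs_neg (g S * _)]
          exact abs_sub _ _
      _ ≤ M * β + (2 * β + M / m) * M :=
          add_le_add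
            (mul_le_mul hg (h.abs_update_sub_le S i z z) (abs_nonneg _) ((abs_nonneg _).trans hg))
            (mul_le_mul hg' (h.abs_le _ _) (abs_nonneg _) ((abs_nonneg _).trans hg'))
      _ = 3 * M * β + M ^ 2 / m := by ring

theorem measure_lt_abs_generalizationGap_le (hm : 0 < m) {ε : ℝ} (hε : 0 < ε) :
    Measure.pi (fun _ => D) {S | ε < |generalizationGap D c S|} ≤
      ENNReal.ofReal ((3 * M * β + M ^ 2 / m) / ε ^ 2) := by
  set P : Measure (Fin m → Z) := Measure.pi fun _ => D
  set g := generalizationGap D c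
  have hint : Integrable (fun S => g S ^ 2) P := by
    refine .of_bound
      ((measurable_generalizationGap D h.measurable).pow_const 2).aestronglyMeasurable
      (M ^ 2) (ae_of_all _ fun S => ?_)
    rw [norm_pow]
    exact pow_le_pow_left₀ (norm_nonneg _) (h.abs_generalizationGap_le hm S) 2
  have hmarkov := mul_meas_ge_le_integral_of_nonneg (ae_of_all _ fun S => sq_nonneg (g S)) hint
    (ε ^ 2)
  have hreal : P.real {S | ε ^ 2 ≤ g S ^ 2} ≤ (3 * M * β + M ^ 2 / m) / ε ^ 2 := by
    rw [le_div_iff₀' (by positivity)]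
    exact hmarkov.trans (h.integral_sq_generalizationGap_le hm)
  calc P {S | ε < |g S|} ≤ P {S | ε ^ 2 ≤ g S ^ 2} :=
        measure_mono fun S (hS : ε < |g S|) => by
          rw [Set.mem_ofPred_eq, ← sq_abs (g S)]
          exact pow_le_pow_left₀ hε.le hS.le 2
    _ ≤ ENNReal.ofReal ((3 * M * β + M ^ 2 / m) / ε ^ 2) := by
        rw [← ofReal_measureReal]
        exact ENNReal.ofReal_le_ofReal hreal

theorem measure_add_lt_abs_generalizationGap_le (hm : 0 < m) {ε : ℝ} (hε : 0 < ε) :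
    Measure.pi (fun _ => D) {S | ε + β < |generalizationGap D c S|} ≤
      ENNReal.ofReal (2 * Real.exp (-(2 * ε ^ 2 / (m * (2 * β + M / m) ^ 2)))) := by
  have hmcdiarmid := measure_abs_sub_integral_ge_le (fun _ : Fin m => D)
    (measurable_generalizationGap D h.measurable) (h.abs_generalizationGap_update_sub_le hm) hε.le
  rw [Finset.sum_const, Finset.card_univ, Fintype.card_fin, nsmul_eq_mul] at hmcdiarmid
  refine (measure_mono fun S (hS : ε + β < _) => ?_).trans hmcdiarmid
  have hmean := h.abs_integral_generalizationGap_le (D := D) hm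
  have htri := abs_sub_abs_le_abs_sub (generalizationGap D c S)
    (∫ S', generalizationGap D c S' ∂Measure.pi fun _ => D)
  change ε ≤ _
  linarith

end UniformlyStable

end Stability

section LabelSum

open Matrix Finset

variable {V : Type*} [DecidableEq V]

/-- The total of the labels carried by each vertex, where the label `y i` sits at the vertex `v i`.
With all labels equal to `1` this counts the labels of a vertex. -/
def labelSum {ι : Type*} (s : Finset ι) (v : ι → V) (y : ι → ℝ) (u : V) : ℝ :=
  ∑ i ∈ s with v i = u, y i

variable {ι : Type*} {s : Finset ι} {v v' : ι → V} {y y' : ι → ℝ}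

theorem labelSum_congr (hv : ∀ i ∈ s, v i = v' i) (hy : ∀ i ∈ s, y i = y' i) :
    labelSum s v y = labelSum s v' y' := by
  ext u
  simp only [labelSum, sum_filter]
  exact sum_congr rfl fun i hi => by rw [hv i hi, hy i hi]

theorem labelSum_mono (h : ∀ i ∈ s, y i ≤ y' i) : labelSum s v y ≤ labelSum s v y' :=
  fun _ => sum_le_sum fun i hi => h i (mem_filter.1 hi).1

theorem labelSum_one_pos (hs : s.Nonempty) : 0 < labelSum s v 1 := by
  obtain ⟨i, hi⟩ := hs
  refine Pi.lt_def.2 ⟨fun u => sum_nonneg fun _ _ => zero_le_one, v i, ?_⟩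
  exact sum_pos (fun _ _ => one_pos) ⟨i, mem_filter.2 ⟨hi, rfl⟩⟩

theorem abs_labelSum_le {a : ℝ} (hy : ∀ i ∈ s, |y i| ≤ a) (u : V) :
    |labelSum s v y u| ≤ labelSum s v 1 u * a := by
  refine (abs_sum_le_sum_abs _ _).trans ?_
  rw [labelSum, sum_mul]
  exact sum_le_sum fun i hi => by simpa using hy i (mem_filter.1 hi).1

theorem labelSum_erase_add_single [DecidableEq ι] {i : ι} (hi : i ∈ s) (v : ι → V) (y : ι → ℝ) :
    labelSum (s.erase i) v y + Pi.single (v i) (y i) = labelSum s v y := by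
  ext u
  simp only [labelSum, sum_filter, Pi.add_apply, Pi.single_apply, eq_comm (a := u)]
  exact sum_erase_add _ _ hi

variable [Fintype V]

theorem sum_labelSum : ∑ u, labelSum s v y u = ∑ i ∈ s, y i :=
  sum_fiberwise s v y

theorem dotProduct_labelSum (x : V → ℝ) (y : ι → ℝ) :
    x ⬝ᵥ labelSum s v y = ∑ i ∈ s, x (v i) * y i := by
  rw [← sum_fiberwise s v]
  refine sum_congr rfl fun u _ => ?_
  rw [labelSum, mul_sum]
  exact sum_congr rfl fun i hi => by rw [(mem_filter.1 hi).2]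

end LabelSum

namespace WeightedGraph

open Matrix Finset

section Propagate

variable {V : Type*} [Fintype V] [DecidableEq V]

/-- Scalar label propagation: the solution `x` of `(n + c L) x = b`, where `n` counts the labels
and `b` adds up the labels at each vertex. -/
noncomputable def propagate (G : WeightedGraph V) (c : ℝ) {ι : Type*} (s : Finset ι) (v : ι → V)
    (y : ι → ℝ) : V → ℝ :=
  (G.screened c (labelSum s v 1))⁻¹ *ᵥ labelSum s v y

variable {G : WeightedGraph V} {c : ℝ} {ι : Type*} {s : Finset ι} {v v' : ι → V} {y y' : ι → ℝ}

theorem propagate_congr (hv : ∀ i ∈ s, v i = v' i) (hy : ∀ i ∈ s, y i = y' i) :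
    G.propagate c s v y = G.propagate c s v' y' := by
  rw [propagate, propagate, labelSum_congr hv hy, labelSum_congr hv fun _ _ => rfl]

theorem propagate_eq_sum (y : ι → ℝ) (u : V) :
    G.propagate c s v y u = ∑ i ∈ s, (G.screened c (labelSum s v 1))⁻¹ u (v i) * y i :=
  dotProduct_labelSum _ _

theorem screened_propagate (hG : G.graph.Connected) (hc : 0 < c) (hs : s.Nonempty) (y : ι → ℝ) :
    G.screened c (labelSum s v 1) *ᵥ G.propagate c s v y = labelSum s v y :=
  screened_mulVec_inv_mulVec hG hc (labelSum_one_pos hs) _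

theorem abs_propagate_le (hG : G.graph.Connected) (hc : 0 < c) (hs : s.Nonempty) {a : ℝ}
    (hy : ∀ i ∈ s, |y i| ≤ a) (u : V) : |G.propagate c s v y u| ≤ a :=
  abs_le_of_screened hG hc (labelSum_one_pos hs)
    (fun i => .inr (by rw [screened_propagate hG hc hs]; exact abs_labelSum_le hy i)) u

theorem propagate_mono (hG : G.graph.Connected) (hc : 0 < c) (hs : s.Nonempty)
    (h : ∀ i ∈ s, y i ≤ y' i) : G.propagate c s v y ≤ G.propagate c s v y' := by
  rw [← sub_nonneg]
  refine nonneg_of_screened hG hc (labelSum_one_pos (v := v) hs) fun i => .inr ?_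
  rw [mulVec_sub, screened_propagate hG hc hs, screened_propagate hG hc hs]
  exact sub_nonneg.2 (labelSum_mono h i)

variable {l a : ℝ} {i : ι}

theorem abs_propagate_sub_mul_propagate_erase_le [DecidableEq ι] (hG : G.graph.Connected)
    (hc : 0 < c) (hl : G.IsSpectralGap l) (hi : i ∈ s) (hy : ∀ j ∈ s, |y j| ≤ a) (u : V) :
    |G.propagate c s v y u - (1 - (1 / #s + 2 / (c * l))) * G.propagate c (s.erase i) v y u| ≤
      (1 / #s + 2 / (c * l)) * a := by
  have hlpos := hl.pos
  have hs : s.Nonempty := ⟨i, hi⟩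
  rcases (s.erase i).eq_empty_or_nonempty with hempty | hne
  · have hzero : G.propagate c (s.erase i) v y = 0 := by
      rw [hempty, propagate, show labelSum ∅ v y = 0 from rfl, mulVec_zero]
    have hcard : #s = 1 := by rw [← card_erase_add_one hi, hempty, card_empty]
    have ha : 0 ≤ a := (abs_nonneg _).trans (hy i hi)
    rw [hzero, Pi.zero_apply, mul_zero, sub_zero, hcard, Nat.cast_one, div_one, one_add_mul]
    exact (abs_propagate_le hG hc hs hy u).trans (le_add_of_nonneg_right (by positivity))
  · have hsol := screened_propagate hG hc hs (v := v) y
    have hgreen := inv_screened_apply_self_le hG hc (labelSum_one_pos (v := v) hs) hl (v i)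
    rw [sum_labelSum, Pi.one_def, sum_const, nsmul_one, ← Pi.one_def] at hgreen
    rw [← labelSum_erase_add_single hi v y, ← labelSum_erase_add_single hi v 1] at hsol
    rw [← labelSum_erase_add_single hi v 1] at hgreen
    exact abs_sub_mul_le_of_add_label hG hc (labelSum_one_pos hne)
      (screened_propagate hG hc hne y) (abs_labelSum_le fun j hj => hy j (mem_of_mem_erase hj))
      (hy i hi) hsol hgreen u

theorem abs_propagate_sub_propagate_le (hG : G.graph.Connected) (hc : 0 < c)
    (hl : G.IsSpectralGap l) (hi : i ∈ s) (hy : ∀ j ∈ s, |y j| ≤ a) (hy' : ∀ j ∈ s, |y' j| ≤ a)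
    (hvv : ∀ j ≠ i, v j = v' j) (hyy : ∀ j ≠ i, y j = y' j) (u : V) :
    |G.propagate c s v y u - G.propagate c s v' y' u| ≤ 2 * (1 / #s + 2 / (c * l)) * a := by
  classical
  have hcommon : G.propagate c (s.erase i) v y = G.propagate c (s.erase i) v' y' :=
    propagate_congr (fun j hj => hvv j (ne_of_mem_erase hj))
      fun j hj => hyy j (ne_of_mem_erase hj)
  have hdev := abs_propagate_sub_mul_propagate_erase_le hG hc hl hi (v := v) hy u
  have hdev' := abs_propagate_sub_mul_propagate_erase_le hG hc hl hi (v := v') hy' u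
  rw [hcommon] at hdev
  rw [abs_sub_comm] at hdev'
  exact (abs_sub_le _ _ _).trans ((add_le_add hdev hdev').trans_eq (by ring))

end Propagate

section ScalarObjective

variable {V : Type*} [Fintype V] (G : WeightedGraph V) {γ : ℝ} {m : ℕ}

/-- The Tikhonov objective for real labels `y i` at the vertices `v i`. -/
noncomputable def scalarObjective (γ : ℝ) {m : ℕ} (v : Fin m → V) (y : Fin m → ℝ)
    (x : V → ℝ) : ℝ :=
  (m : ℝ)⁻¹ * ∑ i, (x (v i) - y i) ^ 2 +
    γ * (2⁻¹ * ∑ i, ∑ j, G.weight i j * (x i - x j) ^ 2)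

theorem scalarObjective_zero (v : Fin m → V) (y : Fin m → ℝ) :
    G.scalarObjective γ v y 0 = (m : ℝ)⁻¹ * ∑ i, y i ^ 2 := by
  simp [scalarObjective]

theorem scalarObjective_nonneg (hγ : 0 ≤ γ) (v : Fin m → V) (y : Fin m → ℝ) (x : V → ℝ) :
    0 ≤ G.scalarObjective γ v y x :=
  add_nonneg (mul_nonneg (by positivity) (sum_nonneg fun _ _ => sq_nonneg _))
    (mul_nonneg hγ (mul_nonneg (by norm_num) (sum_nonneg fun i _ => sum_nonneg fun j _ =>
      mul_nonneg (G.weight_nonneg i j) (sq_nonneg _))))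

variable [DecidableEq V] {G}

theorem mul_scalarObjective (hm : 0 < m) (v : Fin m → V) (y : Fin m → ℝ) (x : V → ℝ) :
    m * G.scalarObjective γ v y x = x ⬝ᵥ (G.screened (m * γ) (labelSum univ v 1) *ᵥ x) -
      2 * (x ⬝ᵥ labelSum univ v y) + ∑ i, y i ^ 2 := by
  have hm' : (m : ℝ) ≠ 0 := Nat.cast_ne_zero.2 hm.ne'
  have hmass : ∑ u, labelSum univ v 1 u * (x u * x u) = ∑ i, x (v i) ^ 2 := by
    have := dotProduct_labelSum (s := univ) (v := v) (fun u => x u * x u) 1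
    rw [dotProduct_comm] at this
    simpa [dotProduct, sq] using this
  have hsq : ∀ i, (x (v i) - y i) ^ 2 = x (v i) ^ 2 - 2 * (x (v i) * y i) + y i ^ 2 :=
    fun i => by ring
  rw [dotProduct_screened, hmass, dotProduct_labelSum, dotProduct_laplacian, scalarObjective]
  simp only [hsq, sum_add_distrib, sum_sub_distrib, ← mul_sum, ← sq]
  rw [mul_add, mul_inv_cancel_left₀ hm']
  ring

theorem scalarObjective_eq_add (hG : G.graph.Connected) (hγ : 0 < γ) (hm : 0 < m)
    (v : Fin m → V) (y : Fin m → ℝ) (x : V → ℝ) :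
    G.scalarObjective γ v y x = G.scalarObjective γ v y (G.propagate (m * γ) univ v y) +
      (m : ℝ)⁻¹ * ((x - G.propagate (m * γ) univ v y) ⬝ᵥ
        (G.screened (m * γ) (labelSum univ v 1) *ᵥ (x - G.propagate (m * γ) univ v y))) := by
  have hm' : (0 : ℝ) < m := Nat.cast_pos.2 hm
  have : Nonempty (Fin m) := ⟨⟨0, hm⟩⟩
  have hsol := screened_propagate hG (mul_pos hm' hγ) univ_nonempty (v := v) y
  set x₀ := G.propagate (m * γ) univ v y
  refine mul_left_cancel₀ hm'.ne' ?_
  rw [mul_add, mul_inv_cancel_left₀ hm'.ne', mul_scalarObjective hm, mul_scalarObjective hm,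
    mulVec_sub, sub_dotProduct, dotProduct_sub, dotProduct_sub, dotProduct_screened_comm x₀ x, hsol]
  ring

variable (hG : G.graph.Connected) (hγ : 0 < γ) (hm : 0 < m)
include hG hγ hm

theorem posDef_screened_labelSum (v : Fin m → V) :
    (G.screened (m * γ) (labelSum univ v 1)).PosDef :=
  have : Nonempty (Fin m) := ⟨⟨0, hm⟩⟩
  posDef_screened hG (mul_pos (Nat.cast_pos.2 hm) hγ) (labelSum_one_pos univ_nonempty)

theorem scalarObjective_propagate_le (v : Fin m → V) (y : Fin m → ℝ) (x : V → ℝ) :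
    G.scalarObjective γ v y (G.propagate (m * γ) univ v y) ≤ G.scalarObjective γ v y x := by
  rw [scalarObjective_eq_add hG hγ hm v y x]
  refine le_add_of_nonneg_right (mul_nonneg (by positivity) ?_)
  exact (posDef_screened_labelSum hG hγ hm v).posSemidef.dotProduct_mulVec_nonneg _

theorem eq_propagate_of_scalarObjective_le {v : Fin m → V} {y : Fin m → ℝ} {x : V → ℝ}
    (hx : G.scalarObjective γ v y x ≤
      G.scalarObjective γ v y (G.propagate (m * γ) univ v y)) :
    x = G.propagate (m * γ) univ v y := by
  by_contra hne
  refine hx.not_gt ?_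
  rw [scalarObjective_eq_add hG hγ hm v y x]
  exact lt_add_of_pos_right _ (mul_pos (inv_pos.2 (Nat.cast_pos.2 hm))
    ((posDef_screened_labelSum hG hγ hm v).dotProduct_mulVec_pos (sub_ne_zero.2 hne)))

end ScalarObjective

end WeightedGraph

theorem aemeasurable_ofReal_quantile_sub_sq (μ ν : ProbabilityMeasure ℝ) :
    AEMeasurable (fun s => ENNReal.ofReal ((quantile μ s - quantile ν s) ^ 2)) unif :=
  (((aemeasurable_quantile μ).sub (aemeasurable_quantile ν)).pow_const 2).ennreal_ofReal

section Minimizer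

open Finset

variable {V : Type*} [Fintype V] {G : WeightedGraph V} {γ : ℝ} {m : ℕ}

theorem WeightedGraph.ofReal_scalarObjective (hγ : 0 ≤ γ) (hm : 0 < m) (v : Fin m → V)
    (y : Fin m → ℝ) (x : V → ℝ) :
    ENNReal.ofReal (G.scalarObjective γ v y x) =
      (m : ℝ≥0∞)⁻¹ * ∑ i, ENNReal.ofReal ((x (v i) - y i) ^ 2) +
        ENNReal.ofReal γ * (2⁻¹ * ∑ i, ∑ j,
          ENNReal.ofReal (G.weight i j) * ENNReal.ofReal ((x i - x j) ^ 2)) := by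
  have hedge : ∀ i j, 0 ≤ G.weight i j * (x i - x j) ^ 2 := fun i j =>
    mul_nonneg (G.weight_nonneg i j) (sq_nonneg _)
  have henergy : 0 ≤ ∑ i, ∑ j, G.weight i j * (x i - x j) ^ 2 :=
    sum_nonneg fun i _ => sum_nonneg fun j _ => hedge i j
  rw [WeightedGraph.scalarObjective,
    ENNReal.ofReal_add (mul_nonneg (by positivity) (sum_nonneg fun _ _ => sq_nonneg _))
      (by positivity),
    ENNReal.ofReal_mul (by positivity), ENNReal.ofReal_inv_of_pos (Nat.cast_pos.2 hm),
    ENNReal.ofReal_natCast, ENNReal.ofReal_sum_of_nonneg fun _ _ => sq_nonneg _,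
    ENNReal.ofReal_mul hγ, ENNReal.ofReal_mul (by norm_num), ENNReal.ofReal_inv_of_pos two_pos,
    ENNReal.ofReal_ofNat, ENNReal.ofReal_sum_of_nonneg fun i _ => sum_nonneg fun j _ => hedge i j]
  simp only [ENNReal.ofReal_sum_of_nonneg fun j _ => hedge _ j,
    ENNReal.ofReal_mul (G.weight_nonneg _ _)]

theorem graphObjective_eq_lintegral (hγ : 0 ≤ γ) (hm : 0 < m)
    (S : Fin m → V × ProbabilityMeasure ℝ) (f : V → ProbabilityMeasure ℝ) :
    graphObjective G γ S f = ∫⁻ s, ENNReal.ofReal (G.scalarObjective γ (fun i => (S i).1)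
      (fun i => quantile (S i).2 s) fun u => quantile (f u) s) ∂unif := by
  have hfit := fun i => aemeasurable_ofReal_quantile_sub_sq (f (S i).1) (S i).2
  have hedge := fun i j =>
    (aemeasurable_ofReal_quantile_sub_sq (f i) (f j)).const_mul (ENNReal.ofReal (G.weight i j))
  have hrow := fun i => Finset.aemeasurable_fun_sum univ fun j _ => hedge i j
  simp only [G.ofReal_scalarObjective hγ hm]
  rw [lintegral_add_left' ((Finset.aemeasurable_fun_sum _ fun i _ => hfit i).const_mul _),
    lintegral_const_mul'' _ (Finset.aemeasurable_fun_sum _ fun i _ => hfit i),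
    lintegral_finsetSum' _ fun i _ => hfit i,
    lintegral_const_mul'' _ ((Finset.aemeasurable_fun_sum _ fun i _ => hrow i).const_mul _),
    lintegral_const_mul'' _ (Finset.aemeasurable_fun_sum _ fun i _ => hrow i),
    lintegral_finsetSum' _ fun i _ => hrow i]
  simp only [lintegral_finsetSum' _ fun j _ => hedge _ j,
    lintegral_const_mul'' _ (aemeasurable_ofReal_quantile_sub_sq _ _), graphObjective,
    empiricalRisk, W2sq_eq_lintegral_quantile]

theorem aemeasurable_scalarObjective_quantile (v : Fin m → V) (μ : Fin m → ProbabilityMeasure ℝ)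
    (f : V → ProbabilityMeasure ℝ) :
    AEMeasurable (fun s => G.scalarObjective γ v (fun i => quantile (μ i) s)
      fun u => quantile (f u) s) unif := by
  have hquad := fun μ ν =>
    ((aemeasurable_quantile μ).sub (aemeasurable_quantile ν)).pow_const 2
  exact ((Finset.aemeasurable_fun_sum _ fun i _ => hquad _ _).const_mul _).add
    (((Finset.aemeasurable_fun_sum _ fun i _ => Finset.aemeasurable_fun_sum _ fun j _ =>
      (hquad _ _).const_mul _).const_mul _).const_mul _)

variable [DecidableEq V]

theorem exists_quantile_ae_eq_propagate (hG : G.graph.Connected) {c : ℝ} (hc : 0 < c) {ι : Type*}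
    {s : Finset ι} (hs : s.Nonempty) (v : ι → V) (μ : ι → ProbabilityMeasure ℝ) :
    ∃ g : V → ProbabilityMeasure ℝ, ∀ᵐ t ∂unif,
      (fun u => quantile (g u) t) = G.propagate c s v fun i => quantile (μ i) t := by
  have hmono : ∀ u, MonotoneOn (fun t => G.propagate c s v (fun i => quantile (μ i) t) u)
      (Set.Ioo 0 1) := fun u t ht t' ht' htt' =>
    WeightedGraph.propagate_mono hG hc hs (fun i _ => monotoneOn_quantile _ ht ht' htt') u
  choose g hg using fun u => exists_quantile_ae_eq (hmono u)
  refine ⟨g, ?_⟩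
  filter_upwards [ae_all_iff.2 hg] with t ht
  exact funext ht

theorem lintegral_scalarObjective_propagate_ne_top (hG : G.graph.Connected) (hγ : 0 < γ)
    (hm : 0 < m) (v : Fin m → V) {μ : Fin m → ProbabilityMeasure ℝ}
    (hμ : ∀ i, Integrable (fun s => quantile (μ i) s ^ 2) unif) :
    ∫⁻ s, ENNReal.ofReal (G.scalarObjective γ v (fun i => quantile (μ i) s)
      (G.propagate (m * γ) univ v fun i => quantile (μ i) s)) ∂unif ≠ ∞ := by
  have hzero : Integrable (fun s => (m : ℝ)⁻¹ * ∑ i, quantile (μ i) s ^ 2) unif :=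
    (integrable_finsetSum _ fun i _ => hμ i).const_mul _
  refine ne_top_of_le_ne_top hzero.lintegral_lt_top.ne (lintegral_mono fun s => ?_)
  rw [← G.scalarObjective_zero]
  exact ENNReal.ofReal_le_ofReal (WeightedGraph.scalarObjective_propagate_le hG hγ hm _ _ _)

-- At almost every level the quantiles of a minimizer minimize the scalar objective, since its
-- scalar minimizers are the quantiles of a competitor.
theorem quantile_ae_eq_propagate_of_graphObjective_le (hG : G.graph.Connected) (hγ : 0 < γ)
    (hm : 0 < m) {S : Fin m → V × ProbabilityMeasure ℝ}
    (hS : ∀ i, Integrable (fun s => quantile (S i).2 s ^ 2) unif) {f : V → ProbabilityMeasure ℝ}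
    (hf : ∀ g, graphObjective G γ S f ≤ graphObjective G γ S g) :
    ∀ᵐ s ∂unif, (fun u => quantile (f u) s) =
      G.propagate (m * γ) univ (fun i => (S i).1) fun i => quantile (S i).2 s := by
  have : Nonempty (Fin m) := ⟨⟨0, hm⟩⟩
  set J : ℝ → (V → ℝ) → ℝ := fun s x =>
    G.scalarObjective γ (fun i => (S i).1) (fun i => quantile (S i).2 s) x
  set x₀ : ℝ → V → ℝ := fun s =>
    G.propagate (m * γ) univ (fun i => (S i).1) fun i => quantile (S i).2 s
  obtain ⟨g, hg⟩ := exists_quantile_ae_eq_propagate hG (mul_pos (Nat.cast_pos.2 hm) hγ)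
    univ_nonempty (fun i => (S i).1) fun i => (S i).2
  have hle : ∫⁻ s, ENNReal.ofReal (J s fun u => quantile (f u) s) ∂unif ≤
      ∫⁻ s, ENNReal.ofReal (J s (x₀ s)) ∂unif := by
    rw [← graphObjective_eq_lintegral hγ.le hm]
    refine ((hf g).trans_eq (graphObjective_eq_lintegral hγ.le hm S g)).trans_eq
      (lintegral_congr_ae ?_)
    filter_upwards [hg] with s hs
    rw [hs]
  have hJ : (fun s => ENNReal.ofReal (J s (x₀ s))) =ᵐ[unif]
      fun s => ENNReal.ofReal (J s fun u => quantile (f u) s) :=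
    ae_eq_of_ae_le_of_lintegral_le
      (ae_of_all _ fun s => ENNReal.ofReal_le_ofReal
        (WeightedGraph.scalarObjective_propagate_le hG hγ hm _ _ _))
      (lintegral_scalarObjective_propagate_ne_top hG hγ hm _ hS)
      (aemeasurable_scalarObjective_quantile _ _ f).ennreal_ofReal hle
  filter_upwards [hJ] with s hs
  exact WeightedGraph.eq_propagate_of_scalarObjective_le hG hγ hm
    ((ENNReal.ofReal_le_ofReal_iff (G.scalarObjective_nonneg hγ.le _ _ _)).1 hs.ge)

end Minimizer

section Hypergraph

open Finset

variable {V : Type*}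

theorem card_inv_mul_sum_sub_sq {E : Finset V} (hE : E.Nonempty) (a : V → ℝ) (t : ℝ) :
    (#E : ℝ)⁻¹ * ∑ i ∈ E, (a i - t) ^ 2 =
      1 / (#E : ℝ) ^ 2 * (2⁻¹ * ∑ i ∈ E, ∑ j ∈ E, (a i - a j) ^ 2) +
        ((#E : ℝ)⁻¹ * ∑ i ∈ E, a i - t) ^ 2 := by
  have hcard : (#E : ℝ) ≠ 0 := Nat.cast_ne_zero.2 hE.card_pos.ne'
  simp only [sub_sq, sum_add_distrib, sum_sub_distrib, sum_const, nsmul_eq_mul, ← mul_sum,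
    ← sum_mul]
  field_simp
  ring

/-- The value at the level `s` of the normalized sum of the squared distances of the pairs of
vertices of the hyperedge `E`. -/
noncomputable def pairDispersion (f : V → ProbabilityMeasure ℝ) (E : Finset V) (s : ℝ) : ℝ :=
  1 / (#E : ℝ) ^ 2 * (2⁻¹ * ∑ i ∈ E, ∑ j ∈ E, (quantile (f i) s - quantile (f j) s) ^ 2)

theorem lintegral_pairDispersion (f : V → ProbabilityMeasure ℝ) (E : Finset V) :
    ∫⁻ s, ENNReal.ofReal (pairDispersion f E s) ∂unif =
      ENNReal.ofReal (1 / (#E : ℝ) ^ 2) * (2⁻¹ * ∑ i ∈ E, ∑ j ∈ E, W2sq (f i) (f j)) := by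
  have hrow := fun i => Finset.aemeasurable_fun_sum E fun j _ =>
    aemeasurable_ofReal_quantile_sub_sq (f i) (f j)
  have hsum := Finset.aemeasurable_fun_sum E fun i _ => hrow i
  have hlevel : ∀ s, ENNReal.ofReal (pairDispersion f E s) = ENNReal.ofReal (1 / (#E : ℝ) ^ 2) *
      (2⁻¹ * ∑ i ∈ E, ∑ j ∈ E, ENNReal.ofReal ((quantile (f i) s - quantile (f j) s) ^ 2)) := by
    intro s
    rw [pairDispersion, ENNReal.ofReal_mul (by positivity), ENNReal.ofReal_mul (by norm_num),
      ENNReal.ofReal_inv_of_pos two_pos, ENNReal.ofReal_ofNat,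
      ENNReal.ofReal_sum_of_nonneg fun _ _ => sum_nonneg fun _ _ => sq_nonneg _]
    simp only [ENNReal.ofReal_sum_of_nonneg fun _ _ => sq_nonneg _]
  simp only [hlevel]
  rw [lintegral_const_mul'' _ (hsum.const_mul _), lintegral_const_mul'' _ hsum,
    lintegral_finsetSum' _ fun i _ => hrow i]
  simp only [lintegral_finsetSum' _ fun _ _ => aemeasurable_ofReal_quantile_sub_sq _ _,
    W2sq_eq_lintegral_quantile]

theorem card_inv_mul_sum_W2sq {E : Finset V} (hE : E.Nonempty) (f : V → ProbabilityMeasure ℝ)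
    (ν : ProbabilityMeasure ℝ) :
    (#E : ℝ≥0∞)⁻¹ * ∑ i ∈ E, W2sq (f i) ν = ∫⁻ s, ENNReal.ofReal (pairDispersion f E s +
      ((#E : ℝ)⁻¹ * ∑ i ∈ E, quantile (f i) s - quantile ν s) ^ 2) ∂unif := by
  simp only [W2sq_eq_lintegral_quantile]
  rw [← lintegral_finsetSum' _ fun i _ => aemeasurable_ofReal_quantile_sub_sq _ _,
    ← lintegral_const_mul'' _ (Finset.aemeasurable_fun_sum _ fun i _ =>
      aemeasurable_ofReal_quantile_sub_sq _ _)]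
  refine lintegral_congr fun s => ?_
  rw [pairDispersion, ← card_inv_mul_sum_sub_sq hE fun i => quantile (f i) s,
    ENNReal.ofReal_mul (by positivity), ENNReal.ofReal_inv_of_pos (Nat.cast_pos.2 hE.card_pos),
    ENNReal.ofReal_natCast, ENNReal.ofReal_sum_of_nonneg fun _ _ => sq_nonneg _]

theorem exists_quantile_ae_eq_mean (f : V → ProbabilityMeasure ℝ) (E : Finset V) :
    ∃ ν, quantile ν =ᵐ[unif] fun s => (#E : ℝ)⁻¹ * ∑ i ∈ E, quantile (f i) s :=
  exists_quantile_ae_eq fun _ hs _ ht hst =>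
    mul_le_mul_of_nonneg_left (sum_le_sum fun i _ => monotoneOn_quantile _ hs ht hst)
      (by positivity)

theorem bar_eq_sum_W2sq (f : V → ProbabilityMeasure ℝ) (E : Finset V) :
    bar f E = ENNReal.ofReal (1 / (#E : ℝ) ^ 2) *
      (2⁻¹ * ∑ i ∈ E, ∑ j ∈ E, W2sq (f i) (f j)) := by
  rcases E.eq_empty_or_nonempty with rfl | hE
  · simp [bar]
  rw [← lintegral_pairDispersion]
  refine le_antisymm ?_ (le_iInf fun ν => ?_)
  · obtain ⟨ν, hν⟩ := exists_quantile_ae_eq_mean f E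
    refine (iInf_le _ ν).trans_eq ((card_inv_mul_sum_W2sq hE f ν).trans (lintegral_congr_ae ?_))
    filter_upwards [hν] with s hs
    rw [hs, sub_self, zero_pow two_ne_zero, add_zero]
  · rw [card_inv_mul_sum_W2sq hE]
    exact lintegral_mono fun s => ENNReal.ofReal_le_ofReal (le_add_of_nonneg_right (sq_nonneg _))

variable [DecidableEq V]

theorem ofReal_cliqueGraph_weight_mul (𝓔 : Finset (Finset V)) (i j : V) {a : ℝ≥0∞}
    (ha : i = j → a = 0) :
    ENNReal.ofReal ((cliqueGraph 𝓔).weight i j) * a =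
      ∑ E ∈ 𝓔, if i ∈ E ∧ j ∈ E then ENNReal.ofReal (1 / (#E : ℝ) ^ 2) * a else 0 := by
  rcases eq_or_ne i j with hij | hij
  · simp [ha hij]
  · have hweight : (cliqueGraph 𝓔).weight i j =
        ∑ E ∈ 𝓔 with i ∈ E ∧ j ∈ E, 1 / (#E : ℝ) ^ 2 := if_neg hij
    rw [hweight, ENNReal.ofReal_sum_of_nonneg fun _ _ => by positivity, sum_mul, sum_filter]

variable [Fintype V]

theorem hypergraphObjective_eq_graphObjective (𝓔 : Finset (Finset V)) (γ : ℝ) {m : ℕ}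
    (S : Fin m → V × ProbabilityMeasure ℝ) (f : V → ProbabilityMeasure ℝ) :
    hypergraphObjective 𝓔 γ S f = graphObjective (cliqueGraph 𝓔) γ S f := by
  have hbar : ∀ E, bar f E = 2⁻¹ * ∑ i, ∑ j, if i ∈ E ∧ j ∈ E then
      ENNReal.ofReal (1 / (#E : ℝ) ^ 2) * W2sq (f i) (f j) else 0 := fun E => by
    rw [bar_eq_sum_W2sq, mul_left_comm]
    simp only [ite_and, sum_ite_mem, univ_inter, mul_sum, sum_ite_irrel, sum_const_zero]
  have hweight : ∀ i j, ENNReal.ofReal ((cliqueGraph 𝓔).weight i j) * W2sq (f i) (f j) = _ :=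
    fun i j => ofReal_cliqueGraph_weight_mul 𝓔 i j fun hij => hij ▸ W2sq_self (f i)
  simp only [hypergraphObjective, graphObjective, hbar, hweight, ← mul_sum]
  congr 3
  rw [sum_comm]
  exact sum_congr rfl fun i _ => sum_comm

end Hypergraph

section Cost

open Finset

/-- The quantile function of `μ` truncated to the band `[-ψ, ψ]`: unlike `quantile μ` it is bounded
by `ψ` for every `μ`, and it is jointly measurable in `μ` and the level. -/
noncomputable def truncQuantile (ψ : ℝ → ℝ) (μ : ProbabilityMeasure ℝ) (s : ℝ) : ℝ :=
  max (-ψ s) (min (ψ s) ((Set.Ioo (0 : ℝ) 1).indicator (quantile μ) s))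

variable {ψ : ℝ → ℝ}

theorem abs_truncQuantile_le (hψ0 : ∀ s, 0 ≤ ψ s) (μ : ProbabilityMeasure ℝ) (s : ℝ) :
    |truncQuantile ψ μ s| ≤ ψ s :=
  abs_le.2 ⟨le_max_left _ _, max_le (neg_le_self (hψ0 s)) (min_le_left _ _)⟩

theorem measurable_truncQuantile (hψ : Measurable ψ) :
    Measurable fun p : ProbabilityMeasure ℝ × ℝ => truncQuantile ψ p.1 p.2 :=
  (hψ.comp measurable_snd).neg.max
    ((hψ.comp measurable_snd).min measurable_indicator_quantile)

theorem truncQuantile_ae_eq {μ : ProbabilityMeasure ℝ} (h : ∀ᵐ s ∂unif, |quantile μ s| ≤ ψ s) :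
    truncQuantile ψ μ =ᵐ[unif] quantile μ := by
  filter_upwards [h, ae_unif_mem_Ioo] with s hs hs01
  rw [truncQuantile, Set.indicator_of_mem hs01, min_eq_right (le_of_abs_le hs),
    max_eq_right (neg_le_of_abs_le hs)]

theorem integrable_quantile_sq (hψ2 : Integrable (fun s => ψ s ^ 2) unif)
    {μ : ProbabilityMeasure ℝ} (hμ : ∀ᵐ s ∂unif, |quantile μ s| ≤ ψ s) :
    Integrable (fun s => quantile μ s ^ 2) unif := by
  refine hψ2.mono' ((aemeasurable_quantile μ).pow_const 2).aestronglyMeasurable ?_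
  filter_upwards [hμ] with s hs
  rw [norm_pow]
  exact pow_le_pow_left₀ (norm_nonneg _) hs 2

variable {V : Type*} [Fintype V] [DecidableEq V] (G : WeightedGraph V)

/-- The signed error at the level `s` of the label propagated from the training set `S` at the test
point `z`. -/
noncomputable def residual (c : ℝ) (ψ : ℝ → ℝ) {m : ℕ} (S : Fin m → V × ProbabilityMeasure ℝ)
    (z : V × ProbabilityMeasure ℝ) (s : ℝ) : ℝ :=
  G.propagate c univ (fun i => (S i).1) (fun i => truncQuantile ψ (S i).2 s) z.1 -
    truncQuantile ψ z.2 s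

/-- The squared `L²` norm of the residual at the test point `z`. For labels dominated by `ψ` it is
the squared Wasserstein distance of the propagated label and the label of `z`; the truncation makes
it bounded and jointly measurable for arbitrary labels. -/
noncomputable def propagationCost (c : ℝ) (ψ : ℝ → ℝ) {m : ℕ}
    (S : Fin m → V × ProbabilityMeasure ℝ) (z : V × ProbabilityMeasure ℝ) : ℝ :=
  ∫ s, residual G c ψ S z s ^ 2 ∂unif

variable {G} {c : ℝ} {m : ℕ}

theorem abs_residual_le (hG : G.graph.Connected) (hc : 0 < c) (hψ0 : ∀ s, 0 ≤ ψ s) (hm : 0 < m)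
    (S : Fin m → V × ProbabilityMeasure ℝ) (z : V × ProbabilityMeasure ℝ) (s : ℝ) :
    |residual G c ψ S z s| ≤ 2 * ψ s := by
  have : Nonempty (Fin m) := ⟨⟨0, hm⟩⟩
  rw [two_mul]
  exact (abs_sub _ _).trans (add_le_add
    (WeightedGraph.abs_propagate_le hG hc univ_nonempty
      (fun i _ => abs_truncQuantile_le hψ0 (S i).2 s) z.1)
    (abs_truncQuantile_le hψ0 z.2 s))

theorem residual_sq_le (hG : G.graph.Connected) (hc : 0 < c) (hψ0 : ∀ s, 0 ≤ ψ s) (hm : 0 < m)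
    (S : Fin m → V × ProbabilityMeasure ℝ) (z : V × ProbabilityMeasure ℝ) (s : ℝ) :
    residual G c ψ S z s ^ 2 ≤ 4 * ψ s ^ 2 :=
  calc residual G c ψ S z s ^ 2 = |residual G c ψ S z s| ^ 2 := (sq_abs _).symm
    _ ≤ (2 * ψ s) ^ 2 := pow_le_pow_left₀ (abs_nonneg _) (abs_residual_le hG hc hψ0 hm S z s) 2
    _ = 4 * ψ s ^ 2 := by ring

theorem abs_residual_update_sub_le (hG : G.graph.Connected) (hc : 0 < c) {l : ℝ}
    (hl : G.IsSpectralGap l) (hψ0 : ∀ s, 0 ≤ ψ s) (S : Fin m → V × ProbabilityMeasure ℝ)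
    (i : Fin m) (w z : V × ProbabilityMeasure ℝ) (s : ℝ) :
    |residual G c ψ (Function.update S i w) z s - residual G c ψ S z s| ≤
      2 * (1 / m + 2 / (c * l)) * ψ s := by
  rw [residual, residual, sub_sub_sub_cancel_right]
  have h := WeightedGraph.abs_propagate_sub_propagate_le hG hc hl (mem_univ i)
    (v := fun j => (Function.update S i w j).1) (v' := fun j => (S j).1)
    (fun j _ => abs_truncQuantile_le hψ0 (Function.update S i w j).2 s)
    (fun j _ => abs_truncQuantile_le hψ0 (S j).2 s)
    (fun j hj => by rw [Function.update_of_ne hj])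
    (fun j hj => by rw [Function.update_of_ne hj]) z.1
  rwa [card_univ, Fintype.card_fin] at h

theorem abs_residual_sq_update_sub_le (hG : G.graph.Connected) (hc : 0 < c) {l : ℝ}
    (hl : G.IsSpectralGap l) (hψ0 : ∀ s, 0 ≤ ψ s) (S : Fin m → V × ProbabilityMeasure ℝ)
    (i : Fin m) (w z : V × ProbabilityMeasure ℝ) (s : ℝ) :
    |residual G c ψ (Function.update S i w) z s ^ 2 - residual G c ψ S z s ^ 2| ≤
      8 * (1 / m + 2 / (c * l)) * ψ s ^ 2 := by
  have hsum : |residual G c ψ (Function.update S i w) z s + residual G c ψ S z s| ≤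
      2 * ψ s + 2 * ψ s :=
    (abs_add_le _ _).trans (add_le_add (abs_residual_le hG hc hψ0 i.pos _ z s)
      (abs_residual_le hG hc hψ0 i.pos S z s))
  have hpos : 0 ≤ 2 * ψ s + 2 * ψ s := (abs_nonneg _).trans hsum
  rw [sq_sub_sq, abs_mul]
  calc _ ≤ (2 * ψ s + 2 * ψ s) * (2 * (1 / m + 2 / (c * l)) * ψ s) :=
        mul_le_mul hsum (abs_residual_update_sub_le hG hc hl hψ0 S i w z s) (abs_nonneg _) hpos
    _ = 8 * (1 / m + 2 / (c * l)) * ψ s ^ 2 := by ring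

variable [MeasurableSpace V] [MeasurableSingletonClass V]

theorem measurable_residual {α : Type*} [MeasurableSpace α] (hψ : Measurable ψ)
    {S : α → Fin m → V × ProbabilityMeasure ℝ} {z : α → V × ProbabilityMeasure ℝ} {s : α → ℝ}
    (hS : Measurable S) (hz : Measurable z) (hs : Measurable s) :
    Measurable fun a => residual G c ψ (S a) (z a) (s a) := by
  have htrunc : ∀ {μ : α → ProbabilityMeasure ℝ}, Measurable μ →
      Measurable fun a => truncQuantile ψ (μ a) (s a) := fun hμ =>
    (measurable_truncQuantile hψ).comp (hμ.prodMk hs)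
  have hsample : ∀ i, Measurable fun a => S a i := measurable_pi_iff.1 hS
  have hcoeff : ∀ i, Measurable fun w : (Fin m → V) × V =>
      (G.screened c (labelSum univ w.1 1))⁻¹ w.2 (w.1 i) := fun _ => measurable_of_finite _
  have hvertices : Measurable fun a => ((fun j => (S a j).1 : Fin m → V), (z a).1) :=
    (measurable_pi_lambda _ fun j => (hsample j).fst).prodMk hz.fst
  simp only [residual, WeightedGraph.propagate_eq_sum]
  exact (Finset.measurable_fun_sum _ fun i _ =>
    ((hcoeff i).comp hvertices).mul (htrunc (hsample i).snd)).sub (htrunc hz.snd)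

theorem integrable_residual_sq (hG : G.graph.Connected) (hc : 0 < c) (hψ : Measurable ψ)
    (hψ0 : ∀ s, 0 ≤ ψ s) (hψ2 : Integrable (fun s => ψ s ^ 2) unif) (hm : 0 < m)
    (S : Fin m → V × ProbabilityMeasure ℝ) (z : V × ProbabilityMeasure ℝ) :
    Integrable (fun s => residual G c ψ S z s ^ 2) unif := by
  have hmeas : Measurable (residual G c ψ S z) :=
    measurable_residual hψ measurable_const measurable_const measurable_id
  refine (hψ2.const_mul 4).mono' (hmeas.pow_const 2).aestronglyMeasurable (ae_of_all _ fun s => ?_)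
  rw [Real.norm_of_nonneg (sq_nonneg _)]
  exact residual_sq_le hG hc hψ0 hm S z s

theorem uniformlyStable_propagationCost (hG : G.graph.Connected) (hc : 0 < c) {l : ℝ}
    (hl : G.IsSpectralGap l) (hψ : Measurable ψ) (hψ0 : ∀ s, 0 ≤ ψ s)
    (hψ2 : Integrable (fun s => ψ s ^ 2) unif) (hm : 0 < m) :
    UniformlyStable (propagationCost G c ψ (m := m)) (4 * ∫ s, ψ s ^ 2 ∂unif)
      (8 * (1 / m + 2 / (c * l)) * ∫ s, ψ s ^ 2 ∂unif) where
  measurable :=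
    ((measurable_residual hψ measurable_fst.fst measurable_fst.snd measurable_snd).pow_const
      2).stronglyMeasurable.integral_prod_right'.measurable
  nonneg _ _ := integral_nonneg fun _ => sq_nonneg _
  le S z := by
    rw [← integral_const_mul]
    exact integral_mono (integrable_residual_sq hG hc hψ hψ0 hψ2 hm S z) (hψ2.const_mul 4)
      (residual_sq_le hG hc hψ0 hm S z)
  abs_update_sub_le S i w z := by
    rw [propagationCost, propagationCost,
      ← integral_sub (integrable_residual_sq hG hc hψ hψ0 hψ2 hm _ z)
        (integrable_residual_sq hG hc hψ hψ0 hψ2 hm S z), ← integral_const_mul,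
      ← Real.norm_eq_abs]
    exact norm_integral_le_of_norm_le (hψ2.const_mul _) (ae_of_all _ fun s =>
      abs_residual_sq_update_sub_le hG hc hl hψ0 S i w z s)

theorem W2sq_eq_ofReal_propagationCost {γ : ℝ} (hG : G.graph.Connected) (hγ : 0 < γ)
    (hψ : Measurable ψ) (hψ0 : ∀ s, 0 ≤ ψ s) (hψ2 : Integrable (fun s => ψ s ^ 2) unif)
    (hm : 0 < m) {S : Fin m → V × ProbabilityMeasure ℝ}
    (hS : ∀ i, ∀ᵐ s ∂unif, |quantile (S i).2 s| ≤ ψ s) {f : V → ProbabilityMeasure ℝ}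
    (hf : ∀ g, graphObjective G γ S f ≤ graphObjective G γ S g)
    {z : V × ProbabilityMeasure ℝ} (hz : ∀ᵐ s ∂unif, |quantile z.2 s| ≤ ψ s) :
    W2sq (f z.1) z.2 = ENNReal.ofReal (propagationCost G (m * γ) ψ S z) := by
  have hc : 0 < m * γ := mul_pos (Nat.cast_pos.2 hm) hγ
  have hmin := quantile_ae_eq_propagate_of_graphObjective_le hG hγ hm
    (fun i => integrable_quantile_sq hψ2 (hS i)) hf
  have htrunc : ∀ᵐ s ∂unif, ∀ i, truncQuantile ψ (S i).2 s = quantile (S i).2 s :=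
    ae_all_iff.2 fun i => truncQuantile_ae_eq (hS i)
  rw [W2sq_eq_lintegral_quantile, propagationCost, ofReal_integral_eq_lintegral_ofReal
    (integrable_residual_sq hG hc hψ hψ0 hψ2 hm S z) (ae_of_all _ fun _ => sq_nonneg _)]
  refine lintegral_congr_ae ?_
  filter_upwards [hmin, htrunc, truncQuantile_ae_eq hz] with s hmin htrain htest
  simp only [residual, htrain, htest, ← hmin]

end Cost

section RiskGap

open Finset

variable {V : Type*} [MeasurableSpace V] {D : Measure (V × ProbabilityMeasure ℝ)} {m : ℕ}

/-- The two tail bounds of a `β`-uniformly stable learning algorithm `A` with costs in `[0, M]`: a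
second moment bound for the risk gap, and an exponential bound for its excess over `β`. -/
def RiskGapBounds (D : Measure (V × ProbabilityMeasure ℝ))
    (A : (Fin m → V × ProbabilityMeasure ℝ) → V → ProbabilityMeasure ℝ) (M β : ℝ) : Prop :=
  ∀ ε : ℝ, 0 < ε →
    Measure.pi (fun _ : Fin m => D) {S | ε < riskGap D S (A S)} ≤
      ENNReal.ofReal ((3 * M * β + M ^ 2 / m) / ε ^ 2) ∧
    Measure.pi (fun _ : Fin m => D) {S | ε + β < riskGap D S (A S)} ≤
      ENNReal.ofReal (2 * Real.exp (-(2 * ε ^ 2 / (m * (2 * β + M / m) ^ 2))))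

variable {A : (Fin m → V × ProbabilityMeasure ℝ) → V → ProbabilityMeasure ℝ} {M β β₀ : ℝ}

theorem riskGap_eq_abs_generalizationGap [IsProbabilityMeasure D]
    {c : (Fin m → V × ProbabilityMeasure ℝ) → V × ProbabilityMeasure ℝ → ℝ}
    (hc : UniformlyStable c M β) {S : Fin m → V × ProbabilityMeasure ℝ}
    {f : V → ProbabilityMeasure ℝ}
    (hS : ∀ i, W2sq (f (S i).1) (S i).2 = ENNReal.ofReal (c S (S i)))
    (hD : ∀ᵐ z ∂D, W2sq (f z.1) z.2 = ENNReal.ofReal (c S z)) :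
    riskGap D S f = |generalizationGap D c S| := by
  have hemp : (empiricalRisk S f).toReal = (m : ℝ)⁻¹ * ∑ i, c S (S i) := by
    simp only [empiricalRisk, hS]
    rw [← ENNReal.ofReal_sum_of_nonneg fun i _ => hc.nonneg _ _, ENNReal.toReal_mul,
      ENNReal.toReal_ofReal (sum_nonneg fun i _ => hc.nonneg _ _), ENNReal.toReal_inv,
      ENNReal.toReal_natCast]
  have htrue : (trueRisk D f).toReal = ∫ z, c S z ∂D := by
    rw [trueRisk, lintegral_congr_ae hD, ← ofReal_integral_eq_lintegral_ofReal
      (hc.integrable S) (ae_of_all _ (hc.nonneg S)),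
      ENNReal.toReal_ofReal (integral_nonneg (hc.nonneg S))]
  rw [riskGap, hemp, htrue, generalizationGap, abs_sub_comm]

theorem UniformlyStable.riskGapBounds [IsProbabilityMeasure D]
    {c : (Fin m → V × ProbabilityMeasure ℝ) → V × ProbabilityMeasure ℝ → ℝ}
    (hc : UniformlyStable c M β) (hm : 0 < m)
    (hA : ∀ᵐ S ∂(Measure.pi fun _ : Fin m => D), riskGap D S (A S) = |generalizationGap D c S|) :
    RiskGapBounds D A M β := by
  have htail : ∀ t, Measure.pi (fun _ : Fin m => D) {S | t < riskGap D S (A S)} =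
      Measure.pi (fun _ : Fin m => D) {S | t < |generalizationGap D c S|} := fun t => by
    refine measure_congr ?_
    filter_upwards [hA] with S hS
    exact congrArg (t < ·) hS
  intro ε hε
  rw [htail, htail]
  exact ⟨hc.measure_lt_abs_generalizationGap_le hm hε,
    hc.measure_add_lt_abs_generalizationGap_le hm hε⟩

theorem three_mul_add_div_le (hm : 0 < m) (hM : 0 ≤ M) (hβ₀ : 0 ≤ β₀) (hβ : β₀ ≤ β) (ε : ℝ) :
    (3 * M * β₀ + M ^ 2 / m) / ε ^ 2 ≤ (64 * M * m * β + 8 * M ^ 2) / (m * ε ^ 2) := by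
  have : (0 : ℝ) < m := Nat.cast_pos.2 hm
  have hMβ : M * β₀ ≤ M * β := mul_le_mul_of_nonneg_left hβ hM
  have hMβ₀ : 0 ≤ M * β₀ := mul_nonneg hM hβ₀
  have hMm : 0 ≤ M ^ 2 / m := by positivity
  have hsplit : (64 * M * m * β + 8 * M ^ 2) / m = 64 * (M * β) + 8 * (M ^ 2 / m) := by
    field_simp
  rw [← div_div, hsplit]
  exact div_le_div_of_nonneg_right (by linarith) (sq_nonneg ε)

-- For `M = β = 0` both sides are `0` by the convention `x / 0 = 0`.
theorem mul_sq_div_le_two_mul_sq_div (hm : 0 < m) (hM : 0 ≤ M) (hβ₀ : 0 ≤ β₀) (hβ : β₀ ≤ β)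
    (hβM : M = 0 → β = 0) (ε : ℝ) :
    m * ε ^ 2 / (2 * (m * β + M) ^ 2) ≤ 2 * ε ^ 2 / (m * (2 * β₀ + M / m) ^ 2) := by
  have : (0 : ℝ) < m := Nat.cast_pos.2 hm
  rcases hM.eq_or_lt with rfl | hM
  · rw [hβM rfl]
    simp only [mul_zero, add_zero, zero_pow two_ne_zero, div_zero]
    positivity
  · have : 0 < m * β₀ + M / 2 := by positivity
    have : 0 < 2 * β₀ + M / m := by positivity
    have hrescale : 2 * ε ^ 2 / (m * (2 * β₀ + M / m) ^ 2) =
        m * ε ^ 2 / (2 * (m * β₀ + M / 2) ^ 2) := by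
      field_simp
    rw [hrescale]
    gcongr
    exact half_le_self hM.le

theorem RiskGapBounds.generalizationBounds [Fintype V] [DecidableEq V]
    (h : RiskGapBounds D A M β₀) (hm : 0 < m) (hM : 0 ≤ M) (hβ₀ : 0 ≤ β₀) (hβ : β₀ ≤ β)
    (hβM : M = 0 → β = 0) (T : ℕ) : GeneralizationBounds D A T M β := by
  intro ε hε
  obtain ⟨hpoly, hexp⟩ := h ε hε
  refine ⟨fun _ => ?_, ?_⟩
  · exact (measure_mono fun S hS => hS.2).trans
      (hpoly.trans (ENNReal.ofReal_le_ofReal (three_mul_add_div_le hm hM hβ₀ hβ ε)))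
  · refine (measure_mono fun S hS => (add_le_add_right hβ ε).trans_lt hS.2).trans
      (hexp.trans (ENNReal.ofReal_le_ofReal ?_))
    gcongr 2 * Real.exp (-?_)
    exact mul_sq_div_le_two_mul_sq_div hm hM hβ₀ hβ hβM ε

theorem sqNorm_nonneg (φ : ℝ → ℝ) : 0 ≤ sqNorm φ := integral_nonneg fun _ => sq_nonneg _

theorem le_beta (φ : ℝ → ℝ) {T : ℕ} {γ l : ℝ} (hT : (T : ℝ) < m * γ * l) :
    4 * sqNorm φ * (4 / (m * γ * l) + 2 / m) ≤ beta φ m T γ l := by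
  have hgap : 0 < m * γ * l - T := sub_pos.2 hT
  have hfour : 4 / (m * γ * l) ≤ 4 / (m * γ * l - T) :=
    div_le_div_of_nonneg_left (by norm_num) hgap (sub_le_self _ T.cast_nonneg)
  have hsqrt : 0 ≤ 3 * √((T : ℝ) * m) / (m * γ * l - T) ^ 2 := by positivity
  exact mul_le_mul_of_nonneg_left (by linarith) (mul_nonneg (by norm_num) (sqNorm_nonneg φ))

theorem RiskGapBounds.generalizationBounds_beta [Fintype V] [DecidableEq V] {φ : ℝ → ℝ} {γ l : ℝ}
    (h : RiskGapBounds D A (4 * sqNorm φ) (4 * sqNorm φ * (4 / (m * γ * l) + 2 / m)))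
    (hm : 0 < m) {T : ℕ} (hT : (T : ℝ) < m * γ * l) :
    GeneralizationBounds D A T (4 * sqNorm φ) (beta φ m T γ l) := by
  have hcl : 0 < m * γ * l := T.cast_nonneg.trans_lt hT
  have hN := sqNorm_nonneg φ
  exact h.generalizationBounds hm (by positivity) (by positivity) (le_beta φ hT)
    (fun hM => by rw [beta, hM, zero_mul]) T

end RiskGap

section Graph

variable {φ : ℝ → ℝ}

theorem exists_measurable_dominating (hφ : MemLp φ 2 (volume.restrict (Set.Icc (0 : ℝ) 1))) :
    ∃ ψ : ℝ → ℝ, Measurable ψ ∧ (∀ s, 0 ≤ ψ s) ∧ Integrable (fun s => ψ s ^ 2) unif ∧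
      ∫ s, ψ s ^ 2 ∂unif = sqNorm φ ∧
      ∀ μ ∈ dominatedQuantileClass φ, ∀ᵐ s ∂unif, |quantile μ s| ≤ ψ s := by
  simp only [sqNorm, dominatedQuantileClass, Set.mem_ofPred_eq, ← unif_eq_restrict_Icc] at hφ ⊢
  have hmk := hφ.1.ae_eq_mk
  have hsq : (fun s => φ s ^ 2) =ᵐ[unif] fun s => |hφ.1.mk φ s| ^ 2 := by
    filter_upwards [hmk] with s hs
    rw [hs, sq_abs]
  refine ⟨fun s => |hφ.1.mk φ s|, hφ.1.stronglyMeasurable_mk.measurable.abs,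
    fun _ => abs_nonneg _, hφ.integrable_sq.congr hsq, (integral_congr_ae hsq).symm,
    fun μ hμ => ?_⟩
  filter_upwards [hμ, hmk] with s hs hmk
  exact hs.trans (hmk ▸ le_abs_self _)

variable {V : Type*} [Fintype V] [DecidableEq V] [MeasurableSpace V] [MeasurableSingletonClass V]

theorem riskGapBounds_of_graphObjective_le
    (hφ : MemLp φ 2 (volume.restrict (Set.Icc (0 : ℝ) 1)))
    {D : Measure (V × ProbabilityMeasure ℝ)} [IsProbabilityMeasure D]
    (hD : ∀ᵐ z ∂D, z.2 ∈ dominatedQuantileClass φ) {m : ℕ} (hm : 0 < m) {γ : ℝ} (hγ : 0 < γ)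
    {G : WeightedGraph V} {l : ℝ} (hG : G.graph.Connected) (hl : G.IsSpectralGap l)
    {A : (Fin m → V × ProbabilityMeasure ℝ) → V → ProbabilityMeasure ℝ}
    (hA : ∀ᵐ S ∂(Measure.pi fun _ : Fin m => D),
      ∀ f, graphObjective G γ S (A S) ≤ graphObjective G γ S f) :
    RiskGapBounds D A (4 * sqNorm φ) (4 * sqNorm φ * (4 / (m * γ * l) + 2 / m)) := by
  obtain ⟨ψ, hψ, hψ0, hψ2, hnorm, hdom⟩ := exists_measurable_dominating hφ
  have hstable := uniformlyStable_propagationCost hG (mul_pos (Nat.cast_pos.2 hm) hγ) hl hψ hψ0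
    hψ2 hm
  have hβ : 8 * (1 / m + 2 / (m * γ * l)) * sqNorm φ =
      4 * sqNorm φ * (4 / (m * γ * l) + 2 / m) := by ring
  rw [hnorm, hβ] at hstable
  have hS : ∀ᵐ S ∂(Measure.pi fun _ : Fin m => D), ∀ i, (S i).2 ∈ dominatedQuantileClass φ :=
    ae_all_iff.2 fun i => (Measure.quasiMeasurePreserving_eval (fun _ : Fin m => D) i).ae hD
  refine hstable.riskGapBounds hm ?_
  filter_upwards [hA, hS] with S hmin hS
  have hcost : ∀ z : V × ProbabilityMeasure ℝ, z.2 ∈ dominatedQuantileClass φ →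
      W2sq (A S z.1) z.2 = ENNReal.ofReal (propagationCost G (m * γ) ψ S z) := fun z hz =>
    W2sq_eq_ofReal_propagationCost hG hγ hψ hψ0 hψ2 hm (fun i => hdom _ (hS i)) hmin (hdom _ hz)
  exact riskGap_eq_abs_generalizationGap hstable (fun i => hcost _ (hS i)) (hD.mono hcost)

end Graph

end SoftLabel

open MeasureTheory SoftLabel in
theorem theorem4_general {V : Type*} [Fintype V] [DecidableEq V] [MeasurableSpace V]
    [MeasurableSingletonClass V]
    (φ : ℝ → ℝ) (hφ : MemLp φ 2 (volume.restrict (Set.Icc (0 : ℝ) 1)))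
    (D : Measure (V × ProbabilityMeasure ℝ)) [IsProbabilityMeasure D]
    (hD : ∀ᵐ z ∂D, z.2 ∈ dominatedQuantileClass φ)
    (m : ℕ) (hm : 0 < m) (γ : ℝ) (hγ : 0 < γ) :
    (∀ (G : WeightedGraph V) (l : ℝ), G.graph.Connected → G.IsSpectralGap l →
      ∀ A : (Fin m → V × ProbabilityMeasure ℝ) → V → ProbabilityMeasure ℝ,
        (∀ᵐ S ∂(Measure.pi fun _ : Fin m => D), ∀ f, graphObjective G γ S (A S) ≤
          graphObjective G γ S f) →
        RiskGapBounds D A (4 * sqNorm φ) (4 * sqNorm φ * (4 / (m * γ * l) + 2 / m))) ∧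
    (∀ (𝓔 : Finset (Finset V)) (l : ℝ), (cliqueGraph 𝓔).graph.Connected →
      (cliqueGraph 𝓔).IsSpectralGap l →
      ∀ A : (Fin m → V × ProbabilityMeasure ℝ) → V → ProbabilityMeasure ℝ,
        (∀ᵐ S ∂(Measure.pi fun _ : Fin m => D), ∀ f, hypergraphObjective 𝓔 γ S (A S) ≤
          hypergraphObjective 𝓔 γ S f) →
        RiskGapBounds D A (4 * sqNorm φ) (4 * sqNorm φ * (4 / (m * γ * l) + 2 / m))) := by
  simp only [hypergraphObjective_eq_graphObjective]
  exact ⟨fun _ _ hG hl _ hA => riskGapBounds_of_graphObjective_le hφ hD hm hγ hG hl hA,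
    fun _ _ hG hl _ hA => riskGapBounds_of_graphObjective_le hφ hD hm hγ hG hl hA⟩

open MeasureTheory SoftLabel in
theorem theorem4 {V : Type*} [Fintype V] [DecidableEq V] [MeasurableSpace V]
    [MeasurableSingletonClass V]
    (φ : ℝ → ℝ) (hφ : MemLp φ 2 (volume.restrict (Set.Icc (0 : ℝ) 1)))
    (hφ0 : ∀ s ∈ Set.Icc (0 : ℝ) 1, 0 ≤ φ s)
    (D : Measure (V × ProbabilityMeasure ℝ)) [IsProbabilityMeasure D]
    (hD : ∀ᵐ z ∂D, z.2 ∈ dominatedQuantileClass φ)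
    (m : ℕ) (hm : 4 ≤ m) (γ : ℝ) (hγ : 0 < γ) (T : ℕ) (hT : 0 < T) :
    (∀ (G : WeightedGraph V) (l : ℝ), G.graph.Connected → G.IsSpectralGap l →
      (T : ℝ) < m * γ * l →
      ∀ A : (Fin m → V × ProbabilityMeasure ℝ) → V → ProbabilityMeasure ℝ,
        (∀ᵐ S ∂(Measure.pi fun _ : Fin m => D), ∀ f, graphObjective G γ S (A S) ≤
          graphObjective G γ S f) →
        GeneralizationBounds D A T (4 * sqNorm φ) (beta φ m T γ l)) ∧
    (∀ (𝓔 : Finset (Finset V)) (l : ℝ), (cliqueGraph 𝓔).graph.Connected →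
      (cliqueGraph 𝓔).IsSpectralGap l → (T : ℝ) < m * γ * l →
      ∀ A : (Fin m → V × ProbabilityMeasure ℝ) → V → ProbabilityMeasure ℝ,
        (∀ᵐ S ∂(Measure.pi fun _ : Fin m => D), ∀ f, hypergraphObjective 𝓔 γ S (A S) ≤
          hypergraphObjective 𝓔 γ S f) →
        GeneralizationBounds D A T (4 * sqNorm φ) (beta φ m T γ l)) := by
  obtain ⟨hgraph, hhyper⟩ := theorem4_general φ hφ D hD m (by omega) γ hγ
  exact ⟨fun G l hG hl hTl A hA => (hgraph G l hG hl A hA).generalizationBounds_beta (by omega) hTl,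
    fun 𝓔 l hG hl hTl A hA => (hhyper 𝓔 l hG hl A hA).generalizationBounds_beta (by omega) hTl⟩
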